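/- Let $\Phi$ be a smooth real function on an open set $U\subset\mathbb R^2\times\mathbb R^2$ containing $(a,b)$, and suppose it satisfies the cinematic curvature condition at $(a,b)$: $\nabla_y\Phi(a,b)\neq 0$ and $$\det\Big(\nabla_x\begin{bmatrix} e\cdot\nabla_y\Phi(x,y)\\ e\cdot\nabla_y\big(\frac{e\cdot\nabla_y\Phi(x,y)}{|\nabla_y\Phi(x,y)|}\big)\end{bmatrix}\Big|_{(x,y)=(a,b)}\Big)\neq0,$$ where $e$ is a unit vector orthogonal to $\nabla_y\Phi(a,b)$. Notation. For $\rho>0$ put $U_1=B(a,\rho)$, and let $J\subset\mathbb R$ be an open set of radii, for instance $J=(1-\tau,1)$. A curve $\Gamma$ is given by its center $x_0\in U_1$ and radius $r_0\in J$. For $X\subset\mathbb R^2$ and curves $\Gamma=(x_0,r_0)$, $\tilde\Gamma=(\tilde x_0,\tilde r_0)$ let $$\Delta_X(\Gamma,\tilde\Gamma)=\inf\Big\{|y-\tilde y|+\Big|\tfrac{\nabla_y\Phi(x_0,y)}{|\nabla_y\Phi(x_0,y)|}-\tfrac{\nabla_y\Phi(\tilde x_0,\tilde y)}{|\nabla_y\Phi(\tilde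 x_0,\tilde y)|}\Big| : y,\tilde y\in\overline X,\ \Phi(x_0,y)=r_0,\ \Phi(\tilde x_0,\tilde y)=\tilde r_0\Big\}\in[0,\infty],$$ with $\inf\emptyset=\infty$. For $w\in\mathbb R^3$ and $\kappa\ge 0$ let $S_{\Gamma,X}$ be the set of $(x,r)\in U_1\times J$ with $|x-x_0|>\kappa$ for which there is $y\in X$ with $$\Phi(x_0,y)-r_0=w_1,\quad \Phi(x,y)-r=w_2,\quad \nabla_y\Phi(x_0,y)\wedge\nabla_y\Phi(x,y)=w_3,$$ where $z\wedge z'=z_1z_2'-z_2z_1'$. Distances $\operatorname{dist}(S,\tilde\Gamma)$ in the $(x,r)$-space are taken in the metric $|x-x'|+|r-r'|$, with $\operatorname{dist}(\emptyset,\tilde\Gamma)=\infty$. Statement. There is $\varepsilon>0$ such that for all $0<\rho,\alpha\le\varepsilon$ and every $C>1$ there is $K\ge1$ such that the following holds for all open $J\subset\mathbb R$, all $A\ge1$, all $\delta\ge0$, all $w\in\mathbb R^3$ with $|w|\le K^{-1}\delta$, and all curves $\Gamma=(x_0,r_0)\in U_1\times J$, where $S_{\Gamma,X}$ is formed with this $w$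 and with $\kappa=A\delta$. 1. Let $\tilde\Gamma=(\tilde x_0,\tilde r_0)\in U_1\times J$ satisfy $\Delta_{B(b,C^{-1}\alpha)}(\Gamma,\tilde\Gamma)<K^{-1}|x_0-\tilde x_0|$, and put $D=\Delta_{B(b,C^{-1}\alpha)}(\Gamma,\tilde\Gamma)+|w|$. Then $$\Delta_{B(b,\alpha)}(\Gamma,\tilde\Gamma)\le K\big(\operatorname{dist}(S_{\Gamma,B(b,\alpha)},\tilde\Gamma)+|w|\big).$$ If moreover $|\tilde x_0-x_0|>A\delta$ and $[\tilde r_0-KD,\tilde r_0+KD]\subset J$, then there is $r'$ with $|r'-\tilde r_0|\le KD$ and $(\tilde x_0,r')\in S_{\Gamma,B(b,\alpha)}$, and $$\operatorname{dist}(S_{\Gamma,B(b,\alpha)},\tilde\Gamma)\le K\big(\Delta_{B(b,C^{-1}\alpha)}(\Gamma,\tilde\Gamma)+|w|\big).$$ For $w=0$ (where $\delta=0$ is allowed) the error terms $|w|$ vanish. 2. $S_{\Gamma,B(b,\alpha)}$ is a smooth embedded submanifold of dimension $2$ of the $(x,r)$-space (possibly empty), and near each of its points it is the graph $r=f(x)$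 of a smooth function over an open set of the $x$-plane. 3. Let $(x,r)\in S_{\Gamma,B(b,C^{-1}\alpha)}$, $t<K^{-1}|x-x_0|$ and $(r-Kt,r+Kt)\subset J$. Then, with $\pi_x(x',r')=x'$, $$\pi_x\big(S_{\Gamma,B(b,\alpha)}\cap\{(x',r'):|x-x'|<t,\ |r-r'|<Kt\}\big)=\{x'\in U_1:|x-x'|<t,\ |x'-x_0|>A\delta\}.$$ -/

import Mathlib

open scoped ContDiff ENNReal

noncomputable section

/-- The Euclidean plane. -/
abbrev Plane : Type := EuclideanSpace ℝ (Fin 2)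

/-- The space of pairs (centre, radius), which parametrizes curves `{y | Φ x y = r}`. -/
abbrev CurveParam : Type := Plane × ℝ

/-- `z ∧ z' = z₁ z'₂ - z₂ z'₁`. -/
def planeWedge (z z' : Plane) : ℝ := z 0 * z' 1 - z 1 * z' 0

/-- `∇_y Φ (x, y)`. -/
def gradY (Φ : Plane → Plane → ℝ) (x y : Plane) : Plane := gradient (Φ x) y

/-- The unit normal `∇_y Φ (x, y) / |∇_y Φ (x, y)|`. -/
def unitNormal (Φ : Plane → Plane → ℝ) (x y : Plane) : Plane :=
  ‖gradY Φ x y‖⁻¹ • gradY Φ x y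

/-- First row of the curvature matrix before differentiation in `x`: `e · ∇_y Φ`. -/
def curvatureRowOne (Φ : Plane → Plane → ℝ) (e x y : Plane) : ℝ :=
  inner ℝ e (gradY Φ x y)

/-- Second row of the curvature matrix before differentiation in `x`:
`e · ∇_y (e · ∇_y Φ / |∇_y Φ|)`. -/
def curvatureRowTwo (Φ : Plane → Plane → ℝ) (e x y : Plane) : ℝ :=
  inner ℝ e (gradient (fun z : Plane => inner ℝ e (gradY Φ x z) / ‖gradY Φ x z‖) y)

/-- The cinematic curvature condition at `(a, b)`. There are two unit vectors `e` orthogonal to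
`∇_y Φ (a, b)`; they differ by a sign, which does not affect the determinant condition. -/
structure CinematicCurvature (Φ : Plane → Plane → ℝ) (a b : Plane) : Prop where
  gradient_ne_zero : gradY Φ a b ≠ 0
  det_ne_zero : ∀ e : Plane, ‖e‖ = 1 → inner ℝ e (gradY Φ a b) = 0 →
    Matrix.det
      !![gradient (fun x : Plane => curvatureRowOne Φ e x b) a 0,
         gradient (fun x : Plane => curvatureRowOne Φ e x b) a 1;
         gradient (fun x : Plane => curvatureRowTwo Φ e x b) a 0,
         gradient (fun x : Plane => curvatureRowTwo Φ e x b) a 1] ≠ 0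

/-- `Δ_X (Γ, Γ')` for the curves with parameters `p`, `q`: the infimum of
`|y - y'| + |n(y) - n'(y')|` over points `y`, `y'` of the two curves in the closure of `X`,
where `n`, `n'` are the unit normals. It is `∞` if one of the curves misses the closure of `X`. -/
def tangencyGap (Φ : Plane → Plane → ℝ) (X : Set Plane) (p q : CurveParam) : ℝ≥0∞ :=
  ⨅ y ∈ {y : Plane | y ∈ closure X ∧ Φ p.1 y = p.2},
    ⨅ y' ∈ {y' : Plane | y' ∈ closure X ∧ Φ q.1 y' = q.2},
      edist y y' + edist (unitNormal Φ p.1 y) (unitNormal Φ q.1 y')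

/-- The set `V_{Γ,X,w}` of triples `(x, r, y)`, where `Γ` has parameters `p`, centres range over
`U₁` and radii over `J`. -/
def tangencyIncidence (Φ : Plane → Plane → ℝ) (U₁ : Set Plane) (J : Set ℝ) (X : Set Plane)
    (w : EuclideanSpace ℝ (Fin 3)) (p : CurveParam) : Set (CurveParam × Plane) :=
  {v | v.1.1 ∈ U₁ ∧ v.1.2 ∈ J ∧ v.2 ∈ X ∧
    Φ p.1 v.2 - p.2 = w 0 ∧
    Φ v.1.1 v.2 - v.1.2 = w 1 ∧
    planeWedge (gradY Φ p.1 v.2) (gradY Φ v.1.1 v.2) = w 2}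

/-- The tangency surface `S_{Γ,X,w}`: the projection of `V_{Γ,X,w}` to the `(x, r)`-space,
restricted to `|x - x₀| > κ`, where `x₀` is the centre of `Γ`. -/
def tangencySurface (Φ : Plane → Plane → ℝ) (U₁ : Set Plane) (J : Set ℝ) (X : Set Plane)
    (w : EuclideanSpace ℝ (Fin 3)) (κ : ℝ) (p : CurveParam) : Set CurveParam :=
  (Prod.fst '' tangencyIncidence Φ U₁ J X w p) ∩ {q | κ < ‖q.1 - p.1‖}

/-- The distance of `q` from `S` in the metric `d(Γ, Γ') = |x - x'| + |r - r'|`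
(`∞` if `S` is empty). -/
def distToSurface (S : Set CurveParam) (q : CurveParam) : ℝ≥0∞ :=
  ⨅ p ∈ S, edist p.1 q.1 + edist p.2 q.2

/-- `S` is a smooth embedded surface (a submanifold of dimension two) in the three-dimensional
`(x, r)`-space: around each of its points a smooth diffeomorphism between open
sets flattens `S` to the coordinate plane `{r = 0}`. -/
def IsSmoothSurface (S : Set CurveParam) : Prop :=
  ∀ p ∈ S, ∃ e : OpenPartialHomeomorph CurveParam CurveParam,
    p ∈ e.source ∧ ContDiffOn ℝ ∞ e e.source ∧ ContDiffOn ℝ ∞ e.symm e.target ∧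
    e.IsImage S {q | q.2 = 0}

/-- `S` is locally the graph `r = f x` of a smooth function over an open set of the `x`-plane. -/
def IsLocallySmoothGraph (S : Set CurveParam) : Prop :=
  ∀ p ∈ S, ∃ (V : Set Plane) (W : Set ℝ) (f : Plane → ℝ),
    IsOpen V ∧ IsOpen W ∧ p.1 ∈ V ∧ p.2 ∈ W ∧ ContDiffOn ℝ ∞ f V ∧
    S ∩ V ×ˢ W = {q : CurveParam | q.1 ∈ V ∧ q.2 = f q.1}

end

/-! Let G(x, x', y) = ∇_yΦ(x,y) ∧ ∇_yΦ(x',y) (`crossGrad`). A curve with centre x meets the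
perturbed tangency condition with Γ at y when Φ(x₀,y) and G(x₀,x,y) take prescribed values: two
equations for y ∈ ℝ². The radius r is then read off from Φ(x,y). Everything rests on solving this
system with constants uniform in x, although it degenerates as x → x₀, because G vanishes on the
diagonal.

The degeneration is linear, so the right map is y ↦ (|x − x'| Φ(x,y), G(x,x',y)). To first order its
y-derivative is v ↦ (|x − x'| g·v, B(x' − x, v)), where g = ∇_yΦ(a,b) and B is the mixed derivative
of G in (x',y) at (a,a,b). Cinematic curvature says exactly that if u is killed by the x'-derivative
of G, v is orthogonal to g and B(u,v) = 0, then u = 0 or v = 0 (`eq_zero_or_eq_zero_of_tangent`).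
Compactness makes this quantitative (`exists_tangent_lower_bound`). If |G| is small compared with |x
− x'| at a single point, the x'-derivative term is absorbed and the rescaled map is bi-Lipschitz,
with constants proportional to |x − x'|. `eventually_tangencyBounds` records this together with the
comparability of |G| and the distance between unit normals.

The claims are then perturbation arguments: near-tangent curves become exactly (perturbed) tangent
after moving y (`exists_perturbed_tangency`), closeness to the surface gives near-tangency
(`exists_near_tangency`), and solutions survive moving the centre
(`exists_tangency_of_near_centre`). Moving y by s = O(d/|x₀ − x₁|) changes the radius only by O(d)
plus the change of Φ(x₀,·): the second difference of Φ in (x,y) is O(|x₀ − x₁| s). Uniqueness and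
the implicit function theorem make the surface a smooth graph (`tangencySurface_eq_graph`). -/

open Filter Topology Metric Set

/-! ### Maps that are Lipschitz-close to an expanding linear map -/

section QuantitativeInverse

variable {E F : Type*} [NormedAddCommGroup E] [NormedSpace ℝ E] [NormedAddCommGroup F]
  [NormedSpace ℝ F] {f : E → F} {f' : E →L[ℝ] F} {m : ℝ} {s : Set E}

theorem half_norm_sub_le_norm_image_sub (hf' : ∀ v, m * ‖v‖ ≤ ‖f' v‖)
    (hf : ∀ x ∈ s, ∀ y ∈ s, ‖f x - f y - f' (x - y)‖ ≤ m / 2 * ‖x - y‖)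
    {x y : E} (hx : x ∈ s) (hy : y ∈ s) : m / 2 * ‖x - y‖ ≤ ‖f x - f y‖ := by
  have h1 := hf x hx y hy
  have h2 := hf' (x - y)
  have h3 := norm_sub_norm_le (f' (x - y)) (f x - f y)
  rw [norm_sub_rev (f' (x - y))] at h3
  linarith

theorem exists_mem_closedBall_eq [FiniteDimensional ℝ E] [FiniteDimensional ℝ F]
    (hdim : Module.finrank ℝ E = Module.finrank ℝ F) (hm : 0 < m)
    (hf' : ∀ v, m * ‖v‖ ≤ ‖f' v‖)
    (hf : ∀ x ∈ s, ∀ y ∈ s, ‖f x - f y - f' (x - y)‖ ≤ m / 2 * ‖x - y‖)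
    {x : E} {t : ℝ} (ht : 0 ≤ t) (hxs : closedBall x t ⊆ s) {z : F}
    (hz : ‖z - f x‖ ≤ m / 2 * t) : ∃ y ∈ closedBall x t, f y = z := by
  have : CompleteSpace E := FiniteDimensional.complete ℝ E
  have hinj : Function.Injective (f' : E →ₗ[ℝ] F) := by
    rw [← LinearMap.ker_eq_bot, LinearMap.ker_eq_bot']
    intro v hv
    have h := hf' v
    rw [ContinuousLinearMap.coe_coe] at hv
    rw [hv, norm_zero] at h
    have : ‖v‖ ≤ 0 := by nlinarith [norm_nonneg v]
    simpa using this
  let L : E ≃ₗ[ℝ] F := LinearEquiv.ofInjectiveOfFinrankEq (f' : E →ₗ[ℝ] F) hinj hdim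
  have hL : ∀ v, L v = f' v := fun v => rfl
  let R : f'.NonlinearRightInverse :=
    { toFun := L.symm
      nnnorm := (Real.toNNReal m)⁻¹
      bound' := fun z => by
        have h := hf' (L.symm z)
        rw [← hL, L.apply_symm_apply] at h
        rw [NNReal.coe_inv, Real.coe_toNNReal _ hm.le, inv_mul_eq_div, le_div_iff₀ hm]
        linarith
      right_inv' := fun z => by rw [← hL, L.apply_symm_apply] }
  have hA : ApproximatesLinearOn f f' s (Real.toNNReal (m / 2)) := by
    intro u hu v hv
    rw [Real.coe_toNNReal _ (by positivity)]
    exact hf u hu v hv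
  obtain ⟨y, hy, hyz⟩ := hA.surjOn_closedBall_of_nonlinearRightInverse R ht hxs
    (show z ∈ _ by
      rw [mem_closedBall, dist_eq_norm]
      have : ((R.nnnorm : ℝ)⁻¹ - (Real.toNNReal (m / 2) : ℝ)) = m / 2 := by
        simp only [R, NNReal.coe_inv, inv_inv, Real.coe_toNNReal _ hm.le,
          Real.coe_toNNReal _ (half_pos hm).le]
        ring
      rwa [this])
  exact ⟨y, hy, hyz⟩

/-- Since `f - f'` is `m / 2`-Lipschitz near `x`, the derivative `g` is within `m / 2` of `f'` in
operator norm, which is less than the expansion `m` of `f'`. -/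
theorem eq_zero_of_fderiv_eq_zero (hm : 0 < m) (hf' : ∀ v, m * ‖v‖ ≤ ‖f' v‖)
    (hf : ∀ x ∈ s, ∀ y ∈ s, ‖f x - f y - f' (x - y)‖ ≤ m / 2 * ‖x - y‖)
    {x : E} (hs : s ∈ 𝓝 x) {g : E →L[ℝ] F} (hg : HasFDerivAt f g x) {v : E} (hv : g v = 0) :
    v = 0 := by
  have hA : ApproximatesLinearOn f f' s (Real.toNNReal (m / 2)) := by
    intro u hu v hv
    rw [Real.coe_toNNReal _ (by positivity)]
    exact hf u hu v hv
  have h1 := (hg.sub f'.hasFDerivAt).le_of_lipschitzOn hs hA.lipschitzOnWith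
  rw [Real.coe_toNNReal _ (by positivity)] at h1
  have h2 := (g - f').le_of_opNorm_le h1 v
  rw [sub_apply, hv, zero_sub, norm_neg] at h2
  have h3 := hf' v
  have : ‖v‖ ≤ 0 := by nlinarith [norm_nonneg v]
  simpa using this

end QuantitativeInverse

/-! ### Graphs as smooth surfaces -/

theorem isLocallySmoothGraph_graph {V : Set Plane} (hV : IsOpen V) {f : Plane → ℝ}
    (hf : ContDiffOn ℝ ∞ f V) :
    IsLocallySmoothGraph {q : CurveParam | q.1 ∈ V ∧ q.2 = f q.1} := by
  intro p hp
  refine ⟨V, univ, f, hV, isOpen_univ, hp.1, mem_univ _, hf, ?_⟩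
  ext q
  simp only [mem_inter_iff, mem_ofPred_eq, mem_prod, mem_univ, and_true]
  tauto

/-- The shear `(x, r) ↦ (x, r - f x)` flattens the graph. -/
theorem isSmoothSurface_graph {V : Set Plane} (hV : IsOpen V) {f : Plane → ℝ}
    (hf : ContDiffOn ℝ ∞ f V) :
    IsSmoothSurface {q : CurveParam | q.1 ∈ V ∧ q.2 = f q.1} := by
  intro p hp
  have hfst : ContDiffOn ℝ ∞ (fun q : CurveParam => f q.1) (V ×ˢ univ) :=
    hf.comp contDiff_fst.contDiffOn fun q hq => hq.1
  have h1 : ContDiffOn ℝ ∞ (fun q : CurveParam => (q.1, q.2 - f q.1)) (V ×ˢ univ) :=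
    contDiff_fst.contDiffOn.prodMk (contDiff_snd.contDiffOn.sub hfst)
  have h2 : ContDiffOn ℝ ∞ (fun q : CurveParam => (q.1, q.2 + f q.1)) (V ×ˢ univ) :=
    contDiff_fst.contDiffOn.prodMk (contDiff_snd.contDiffOn.add hfst)
  refine ⟨
    { toFun := fun q => (q.1, q.2 - f q.1)
      invFun := fun q => (q.1, q.2 + f q.1)
      source := V ×ˢ univ
      target := V ×ˢ univ
      map_source' := fun q hq => ⟨hq.1, mem_univ _⟩
      map_target' := fun q hq => ⟨hq.1, mem_univ _⟩
      left_inv' := fun q _ => by simp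
      right_inv' := fun q _ => by simp
      open_source := hV.prod isOpen_univ
      open_target := hV.prod isOpen_univ
      continuousOn_toFun := h1.continuousOn
      continuousOn_invFun := h2.continuousOn }, ⟨hp.1, mem_univ _⟩, h1, h2, ?_⟩
  intro q hq
  have hq1 : q.1 ∈ V := hq.1
  simp [sub_eq_zero, hq1]

/-! ### The wedge of two gradients, and smoothness of the derived functions -/

/-- The wedge product `∇_y Φ (x, y) ∧ ∇_y Φ (x', y)`. -/
noncomputable def crossGrad (Φ : Plane → Plane → ℝ) (x x' y : Plane) : ℝ :=
  planeWedge (gradY Φ x y) (gradY Φ x' y)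

theorem crossGrad_self (Φ : Plane → Plane → ℝ) (x y : Plane) : crossGrad Φ x x y = 0 := by
  simp only [crossGrad, planeWedge]; ring

theorem crossGrad_swap (Φ : Plane → Plane → ℝ) (x x' y : Plane) :
    crossGrad Φ x' x y = -crossGrad Φ x x' y := by
  simp only [crossGrad, planeWedge]; ring

theorem ContDiffAt.planeWedge {E : Type*} [NormedAddCommGroup E] [NormedSpace ℝ E]
    {f g : E → Plane} {z : E} {n : ℕ∞ω} (hf : ContDiffAt ℝ n f z) (hg : ContDiffAt ℝ n g z) :
    ContDiffAt ℝ n (fun x => _root_.planeWedge (f x) (g x)) z := by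
  rw [contDiffAt_euclidean] at hf hg
  exact ((hf 0).mul (hg 1)).sub ((hf 1).mul (hg 0))

theorem ContDiffAt.partial_fderiv {E F G : Type*} [NormedAddCommGroup E] [NormedSpace ℝ E]
    [NormedAddCommGroup F] [NormedSpace ℝ F] [NormedAddCommGroup G] [NormedSpace ℝ G]
    {f : E → F → G} {x : E} {y : F} (hf : ContDiffAt ℝ ∞ (fun z : E × F => f z.1 z.2) (x, y)) :
    ContDiffAt ℝ ∞ (fun z : E × F => _root_.fderiv ℝ (f z.1) z.2) (x, y) := by
  refine ContDiffAt.fderiv (f := fun z : E × F => f z.1) (n := ∞) ?_ contDiffAt_snd (by simp)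
  exact hf.comp ((x, y), y)
    ((contDiffAt_fst.comp _ contDiffAt_fst).prodMk contDiffAt_snd)

section Smoothness

variable {Φ : Plane → Plane → ℝ} {x x' y : Plane}

theorem contDiffAt_gradY (h : ContDiffAt ℝ ∞ (fun z : Plane × Plane => Φ z.1 z.2) (x, y)) :
    ContDiffAt ℝ ∞ (fun z : Plane × Plane => gradY Φ z.1 z.2) (x, y) :=
  (InnerProductSpace.toDual ℝ Plane).symm.contDiff.contDiffAt.comp _ h.partial_fderiv

theorem contDiffAt_crossGrad (h : ContDiffAt ℝ ∞ (fun z : Plane × Plane => Φ z.1 z.2) (x, y))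
    (h' : ContDiffAt ℝ ∞ (fun z : Plane × Plane => Φ z.1 z.2) (x', y)) :
    ContDiffAt ℝ ∞ (fun z : (Plane × Plane) × Plane => crossGrad Φ z.1.1 z.1.2 z.2)
      ((x, x'), y) := by
  refine ContDiffAt.planeWedge ?_ ?_
  · exact ContDiffAt.comp (g := fun z : Plane × Plane => gradY Φ z.1 z.2)
      (f := fun z : (Plane × Plane) × Plane => (z.1.1, z.2)) ((x, x'), y) (contDiffAt_gradY h)
      ((contDiffAt_fst.comp _ contDiffAt_fst).prodMk contDiffAt_snd)
  · exact ContDiffAt.comp (g := fun z : Plane × Plane => gradY Φ z.1 z.2)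
      (f := fun z : (Plane × Plane) × Plane => (z.1.2, z.2)) ((x, x'), y) (contDiffAt_gradY h')
      ((contDiffAt_snd.comp _ contDiffAt_fst).prodMk contDiffAt_snd)

theorem contDiffAt_inv_norm_gradY
    (h : ContDiffAt ℝ ∞ (fun z : Plane × Plane => Φ z.1 z.2) (x, y)) (h0 : gradY Φ x y ≠ 0) :
    ContDiffAt ℝ ∞ (fun z : Plane × Plane => ‖gradY Φ z.1 z.2‖⁻¹) (x, y) :=
  ((contDiffAt_gradY h).norm ℝ h0).inv (norm_ne_zero_iff.2 h0)

theorem contDiffAt_unitNormal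
    (h : ContDiffAt ℝ ∞ (fun z : Plane × Plane => Φ z.1 z.2) (x, y)) (h0 : gradY Φ x y ≠ 0) :
    ContDiffAt ℝ ∞ (fun z : Plane × Plane => unitNormal Φ z.1 z.2) (x, y) :=
  (contDiffAt_inv_norm_gradY h h0).smul (contDiffAt_gradY h)

end Smoothness

/-! ### First-order estimates on small balls -/

section Local

variable {E F G : Type*} [NormedAddCommGroup E] [NormedSpace ℝ E]
    [NormedAddCommGroup F] [NormedSpace ℝ F] [NormedAddCommGroup G] [NormedSpace ℝ G]

/-- Local bounds are stated for all large `M` and then all small `R`, so that finitely many of them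
can later be imposed with common constants. -/
theorem ContDiffAt.eventually_lipschitz {f : E × F → G} {a : E} {b : F}
    (hf : ContDiffAt ℝ ∞ f (a, b)) :
    ∀ᶠ M in atTop, ∀ᶠ R in 𝓝[>] (0 : ℝ), ∀ x ∈ ball a R, ∀ x' ∈ ball a R,
      ∀ y ∈ ball b R, ∀ y' ∈ ball b R,
        ‖f (x, y) - f (x', y')‖ ≤ M * (‖x - x'‖ + ‖y - y'‖) := by
  obtain ⟨K, t, ht, hK⟩ := (hf.of_le (m := 1) (by simp)).exists_lipschitzOnWith
  filter_upwards [eventually_ge_atTop (K : ℝ)] with M hM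
  filter_upwards [(eventually_ball_subset ht).filter_mono nhdsWithin_le_nhds] with R hR x hx x' hx' y hy y' hy'
  have h1 : ∀ {p q}, p ∈ ball a R → q ∈ ball b R → (p, q) ∈ t := fun hp hq =>
    hR (by rw [← ball_prod_same]; exact ⟨hp, hq⟩)
  have h2 := hK.dist_le_mul _ (h1 hx hy) _ (h1 hx' hy')
  rw [dist_eq_norm] at h2
  refine h2.trans (mul_le_mul hM ?_ dist_nonneg (K.2.trans hM))
  rw [Prod.dist_eq, dist_eq_norm, dist_eq_norm]
  exact max_le_add_of_nonneg (norm_nonneg _) (norm_nonneg _)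

theorem ContDiffAt.eventually_approx {f : E × F → G} {a : E} {b : F}
    (hf : ContDiffAt ℝ ∞ f (a, b)) {c : ℝ} (hc : 0 < c) :
    ∀ᶠ R in 𝓝[>] (0 : ℝ), ∀ x ∈ ball a R, ∀ x' ∈ ball a R,
      ∀ y ∈ ball b R, ∀ y' ∈ ball b R,
        ‖f (x, y) - f (x', y') - _root_.fderiv ℝ f (a, b) (x - x', y - y')‖
          ≤ c * max ‖x - x'‖ ‖y - y'‖ := by
  obtain ⟨t, ht, hK⟩ := (hf.hasStrictFDerivAt (by simp)).approximates_deriv_on_nhds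
    (c := ⟨c, hc.le⟩) (Or.inr hc)
  filter_upwards [(eventually_ball_subset ht).filter_mono nhdsWithin_le_nhds] with R hR x hx x' hx' y hy y' hy'
  have h1 : ∀ {p q}, p ∈ ball a R → q ∈ ball b R → (p, q) ∈ t := fun hp hq =>
    hR (by rw [← ball_prod_same]; exact ⟨hp, hq⟩)
  exact hK _ (h1 hx hy) _ (h1 hx' hy')

end Local

theorem inner_plane (u v : Plane) : inner ℝ u v = u 0 * v 0 + u 1 * v 1 := by
  simp [PiLp.inner_apply, Fin.sum_univ_two]; ring

theorem norm_sq_plane (u : Plane) : ‖u‖ ^ 2 = u 0 ^ 2 + u 1 ^ 2 := by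
  rw [← real_inner_self_eq_norm_sq, inner_plane]; ring

/-! ### Cinematic curvature as nondegeneracy of the wedge -/

section Nondegeneracy

variable {Φ : Plane → Plane → ℝ} {a b : Plane}

/-- The derivative of `x' ↦ ∇_y Φ (a, b) ∧ ∇_y Φ (x', b)` at `a`. -/
noncomputable def crossDeriv (Φ : Plane → Plane → ℝ) (a b : Plane) : Plane →L[ℝ] ℝ :=
  fderiv ℝ (fun z : (Plane × Plane) × Plane => crossGrad Φ z.1.1 z.1.2 z.2) ((a, a), b) ∘L
    .inl ℝ (Plane × Plane) Plane ∘L .inr ℝ Plane Plane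

/-- The mixed derivative in `(x', y)` of `∇_y Φ (a, y) ∧ ∇_y Φ (x', y)` at `(a, b)`. -/
noncomputable def crossMixedDeriv (Φ : Plane → Plane → ℝ) (a b : Plane) :
    Plane →L[ℝ] Plane →L[ℝ] ℝ :=
  fderiv ℝ (fun z : (Plane × Plane) × Plane => fderiv ℝ (crossGrad Φ z.1.1 z.1.2) z.2)
    ((a, a), b) ∘L .inl ℝ (Plane × Plane) Plane ∘L .inr ℝ Plane Plane

theorem hasFDerivAt_partial {G : Type*} [NormedAddCommGroup G] [NormedSpace ℝ G]
    {f : (Plane × Plane) × Plane → G} (hf : ContDiffAt ℝ ∞ f ((a, a), b)) :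
    HasFDerivAt (fun x => f ((a, x), b)) (fderiv ℝ f ((a, a), b) ∘L
      .inl ℝ (Plane × Plane) Plane ∘L .inr ℝ Plane Plane) a := by
  have h1 : HasFDerivAt f (fderiv ℝ f ((a, a), b)) ((a, a), b) :=
    (hf.differentiableAt (by simp)).hasFDerivAt
  have h2 : HasFDerivAt (fun x : Plane => ((a, x), b))
      (ContinuousLinearMap.inl ℝ (Plane × Plane) Plane ∘L
        ContinuousLinearMap.inr ℝ Plane Plane) a := by
    refine (((hasFDerivAt_const a a).prodMk (hasFDerivAt_id a)).prodMk
      (hasFDerivAt_const b a)).congr_fderiv ?_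
    ext v <;> simp
  exact HasFDerivAt.comp (g := f) a h1 h2

theorem HasFDerivAt.plane_apply {E : Type*} [NormedAddCommGroup E] [NormedSpace ℝ E]
    {h : E → Plane} {h' : E →L[ℝ] Plane} {x : E} (hh : HasFDerivAt h h' x) (i : Fin 2) :
    HasFDerivAt (fun x => h x i) (EuclideanSpace.proj i ∘L h') x :=
  (EuclideanSpace.proj i : Plane →L[ℝ] ℝ).hasFDerivAt.comp x hh

theorem HasFDerivAt.planeWedge_apply {E : Type*} [NormedAddCommGroup E] [NormedSpace ℝ E]
    {h k : E → Plane} {h' k' : E →L[ℝ] Plane} {x : E} {g' : E →L[ℝ] ℝ}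
    (hh : HasFDerivAt h h' x) (hk : HasFDerivAt k k' x)
    (hg : HasFDerivAt (fun x => planeWedge (h x) (k x)) g' x) (u : E) :
    g' u = planeWedge (h' u) (k x) + planeWedge (h x) (k' u) := by
  have h1 := ((hh.plane_apply 0).mul (hk.plane_apply 1)).sub
    ((hh.plane_apply 1).mul (hk.plane_apply 0))
  have h2 := congrArg (fun L => L u) (hg.unique h1)
  simp at h2
  rw [h2]
  simp only [planeWedge]
  ring

theorem contDiffAt_slice {G : Type*} [NormedAddCommGroup G] [NormedSpace ℝ G]
    {f : Plane × Plane → G} {x y : Plane} (hf : ContDiffAt ℝ ∞ f (x, y)) :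
    ContDiffAt ℝ ∞ (fun z => f (x, z)) y :=
  ContDiffAt.comp (g := f) (f := fun z => (x, z)) y hf (contDiffAt_const.prodMk contDiffAt_id)

theorem contDiffAt_slice_left {G : Type*} [NormedAddCommGroup G] [NormedSpace ℝ G]
    {f : Plane × Plane → G} {x y : Plane} (hf : ContDiffAt ℝ ∞ f (x, y)) :
    ContDiffAt ℝ ∞ (fun z => f (z, y)) x :=
  ContDiffAt.comp (g := f) (f := fun z => (z, y)) x hf (contDiffAt_id.prodMk contDiffAt_const)

theorem inner_gradient_eq_fderiv (f : Plane → ℝ) (e y : Plane) :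
    inner ℝ e (gradient f y) = fderiv ℝ f y e := by
  rw [real_inner_comm]
  exact InnerProductSpace.toDual_symm_apply

theorem hasFDerivAt_inner_left {E : Type*} [NormedAddCommGroup E] [NormedSpace ℝ E]
    {h : E → Plane} {h' : E →L[ℝ] Plane} {x : E} (e : Plane) (hh : HasFDerivAt h h' x) :
    HasFDerivAt (fun x => inner ℝ e (h x)) (innerSL ℝ e ∘L h') x :=
  (innerSL ℝ e).hasFDerivAt.comp x hh

section Derivatives

variable (h : ContDiffAt ℝ ∞ (fun z : Plane × Plane => Φ z.1 z.2) (a, b))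
include h

theorem hasFDerivAt_gradY :
    HasFDerivAt (fun x => gradY Φ x b) (fderiv ℝ (fun x => gradY Φ x b) a) a :=
  ((contDiffAt_slice_left (contDiffAt_gradY h)).differentiableAt (by simp)).hasFDerivAt

theorem hasFDerivAt_fderiv_gradY (e : Plane) :
    HasFDerivAt (fun x => fderiv ℝ (gradY Φ x) b e)
      (fderiv ℝ (fun x => fderiv ℝ (gradY Φ x) b e) a) a := by
  have h1 := contDiffAt_slice_left (ContDiffAt.partial_fderiv (contDiffAt_gradY h))
  exact ((h1.clm_apply contDiffAt_const).differentiableAt (by simp)).hasFDerivAt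

theorem hasFDerivAt_gradY_right :
    HasFDerivAt (gradY Φ a) (fderiv ℝ (gradY Φ a) b) b :=
  ((contDiffAt_slice (contDiffAt_gradY h)).differentiableAt (by simp)).hasFDerivAt

theorem crossDeriv_apply (u : Plane) :
    crossDeriv Φ a b u
      = planeWedge (gradY Φ a b) (fderiv ℝ (fun x => gradY Φ x b) a u) := by
  have h1 := HasFDerivAt.planeWedge_apply (hasFDerivAt_const (gradY Φ a b) a)
    (hasFDerivAt_gradY h) (hasFDerivAt_partial (contDiffAt_crossGrad h h)) u
  simpa [planeWedge, crossDeriv] using h1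

theorem crossMixedDeriv_apply
    (hev : ∀ᶠ x in 𝓝 a, ContDiffAt ℝ ∞ (fun z : Plane × Plane => Φ z.1 z.2) (x, b))
    (u e : Plane) :
    crossMixedDeriv Φ a b u e
      = planeWedge (fderiv ℝ (gradY Φ a) b e) (fderiv ℝ (fun x => gradY Φ x b) a u)
        + planeWedge (gradY Φ a b) (fderiv ℝ (fun x => fderiv ℝ (gradY Φ x) b e) a u) := by
  have h1 := hasFDerivAt_partial (ContDiffAt.partial_fderiv (f := fun z : Plane × Plane =>
    crossGrad Φ z.1 z.2) (contDiffAt_crossGrad h h))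
  have h2 : HasFDerivAt (fun x => fderiv ℝ (crossGrad Φ a x) b e)
      ((ContinuousLinearMap.apply ℝ ℝ e) ∘L crossMixedDeriv Φ a b) a :=
    (ContinuousLinearMap.apply ℝ ℝ e).hasFDerivAt.comp a h1
  have h3 : (fun x => fderiv ℝ (crossGrad Φ a x) b e) =ᶠ[𝓝 a] fun x =>
      planeWedge (fderiv ℝ (gradY Φ a) b e) (gradY Φ x b)
        + planeWedge (gradY Φ a b) (fderiv ℝ (gradY Φ x) b e) := by
    filter_upwards [hev] with x hx
    have h4 : HasFDerivAt (crossGrad Φ a x) (fderiv ℝ (crossGrad Φ a x) b) b :=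
      (((contDiffAt_crossGrad h hx).comp (f := fun y : Plane => ((a, x), y)) b
        (contDiffAt_const.prodMk contDiffAt_id)).differentiableAt (by simp)).hasFDerivAt
    exact HasFDerivAt.planeWedge_apply (hasFDerivAt_gradY_right h) (hasFDerivAt_gradY_right hx)
      h4 e
  have h5 := h2.congr_of_eventuallyEq h3.symm
  have w1 := contDiffAt_const (c := fderiv ℝ (gradY Φ a) b e) (x := a) |>.planeWedge
    (contDiffAt_slice_left (contDiffAt_gradY h))
  have w2 := contDiffAt_const (c := gradY Φ a b) (x := a) |>.planeWedge
    ((contDiffAt_slice_left (ContDiffAt.partial_fderiv (contDiffAt_gradY h))).clm_apply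
      (contDiffAt_const (c := e)))
  have d1 := (w1.differentiableAt (by simp)).hasFDerivAt
  have d2 := (w2.differentiableAt (by simp)).hasFDerivAt
  have h6 := congrArg (fun L => L u) (h5.unique (d1.add d2))
  have e1 := HasFDerivAt.planeWedge_apply (hasFDerivAt_const (fderiv ℝ (gradY Φ a) b e) a)
    (hasFDerivAt_gradY h) d1 u
  have e2 := HasFDerivAt.planeWedge_apply (hasFDerivAt_const (gradY Φ a b) a)
    (hasFDerivAt_fderiv_gradY h e) d2 u
  simp only [ContinuousLinearMap.comp_apply, ContinuousLinearMap.apply_apply, add_apply] at h6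
  rw [h6, e1, e2]
  simp [planeWedge]

theorem fderiv_curvatureRowOne (e u : Plane) :
    fderiv ℝ (fun x => curvatureRowOne Φ e x b) a u
      = inner ℝ e (fderiv ℝ (fun x => gradY Φ x b) a u) := by
  rw [show fderiv ℝ (fun x => curvatureRowOne Φ e x b) a = _ from
    (hasFDerivAt_inner_left e (hasFDerivAt_gradY h)).fderiv]
  simp

/-- By the product rule the row is (e·∂_e∇_yΦ)|∇_yΦ|⁻¹ plus a multiple of e·∇_yΦ. Both e·∇_yΦ and
its derivative along `u` vanish at `a`, so the second summand contributes nothing; the cube clears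
denominators. -/
theorem fderiv_curvatureRowTwo
    (hev : ∀ᶠ x in 𝓝 a, ContDiffAt ℝ ∞ (fun z : Plane × Plane => Φ z.1 z.2) (x, b))
    (h0 : gradY Φ a b ≠ 0) {e u : Plane} (he : inner ℝ e (gradY Φ a b) = 0)
    (hu : inner ℝ e (fderiv ℝ (fun x => gradY Φ x b) a u) = 0) :
    ‖gradY Φ a b‖ ^ 3 * fderiv ℝ (fun x => curvatureRowTwo Φ e x b) a u
      = ‖gradY Φ a b‖ ^ 2 * inner ℝ e (fderiv ℝ (fun x => fderiv ℝ (gradY Φ x) b e) a u)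
        - inner ℝ e (fderiv ℝ (gradY Φ a) b e)
          * inner ℝ (gradY Φ a b) (fderiv ℝ (fun x => gradY Φ x b) a u) := by
  have hH := norm_ne_zero_iff.2 h0
  have hne : ∀ᶠ x in 𝓝 a, gradY Φ x b ≠ 0 :=
    (hasFDerivAt_gradY h).continuousAt.eventually_ne h0
  have hrow : (fun x => curvatureRowTwo Φ e x b) =ᶠ[𝓝 a] fun x =>
      inner ℝ e (fderiv ℝ (gradY Φ x) b e) * ‖gradY Φ x b‖⁻¹
        + inner ℝ e (gradY Φ x b) * fderiv ℝ (fun z => ‖gradY Φ x z‖⁻¹) b e := by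
    filter_upwards [hev, hne] with x hx hx0
    have d1 := hasFDerivAt_inner_left e (hasFDerivAt_gradY_right hx)
    have d2 : HasFDerivAt (fun z => ‖gradY Φ x z‖⁻¹) _ b :=
      ((contDiffAt_slice (contDiffAt_inv_norm_gradY hx hx0)).differentiableAt
        (by simp)).hasFDerivAt
    rw [curvatureRowTwo, inner_gradient_eq_fderiv]
    simp only [div_eq_mul_inv]
    rw [show fderiv ℝ (fun z => inner ℝ e (gradY Φ x z) * ‖gradY Φ x z‖⁻¹) b = _ from
      (d1.mul d2).fderiv]
    simp
    ring
  have dN : HasFDerivAt (fun x => ‖gradY Φ x b‖⁻¹) (fderiv ℝ (fun x => ‖gradY Φ x b‖⁻¹) a) a :=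
    ((contDiffAt_slice_left (contDiffAt_inv_norm_gradY h h0)).differentiableAt
      (by simp)).hasFDerivAt
  have dG : HasFDerivAt (fun x => fderiv ℝ (fun z => ‖gradY Φ x z‖⁻¹) b e) _ a :=
    (((contDiffAt_slice_left (ContDiffAt.partial_fderiv (f := fun x z => ‖gradY Φ x z‖⁻¹)
      (contDiffAt_inv_norm_gradY h h0))).clm_apply (contDiffAt_const (c := e))).differentiableAt
      (by simp)).hasFDerivAt
  have d := ((hasFDerivAt_inner_left e (hasFDerivAt_fderiv_gradY h e)).mul dN).add
    ((hasFDerivAt_inner_left e (hasFDerivAt_gradY h)).mul dG)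
  have hfd := congrArg (fun L => L u) (d.congr_of_eventuallyEq hrow).fderiv
  have hN : ‖gradY Φ a b‖ ^ 3 * fderiv ℝ (fun x => ‖gradY Φ x b‖⁻¹) a u
      = -inner ℝ (gradY Φ a b) (fderiv ℝ (fun x => gradY Φ x b) a u) := by
    -- The derivative of the inverse norm comes from differentiating |∇_yΦ|⁻¹ |∇_yΦ|⁻¹ |∇_yΦ|² = 1.
    have e1 := (dN.mul dN).mul (hasFDerivAt_gradY h).norm_sq
    have e2 : (fun x => ‖gradY Φ x b‖⁻¹ * ‖gradY Φ x b‖⁻¹ * ‖gradY Φ x b‖ ^ 2)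
        =ᶠ[𝓝 a] fun _ => 1 := by
      filter_upwards [hne] with x hx
      have := norm_ne_zero_iff.2 hx
      field_simp
    have e3 := congrArg (fun L => L u)
      (e1.unique ((hasFDerivAt_const (1 : ℝ) a).congr_of_eventuallyEq e2))
    simp at e3
    generalize fderiv ℝ (fun x => ‖gradY Φ x b‖⁻¹) a u = N' at e3 ⊢
    field_simp at e3
    linarith
  simp [he, hu] at hfd
  rw [hfd]
  generalize fderiv ℝ (fun x => ‖gradY Φ x b‖⁻¹) a u = N' at hN ⊢
  field_simp
  linear_combination inner ℝ e (fderiv ℝ (gradY Φ a) b e) * hN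

end Derivatives

/-- Normalise `v` to a unit vector `e`, so that `g` is `t` times `e` rotated. Then the first
hypothesis on `u` says that row one of the curvature matrix kills `u`. Given this, |g|³ times the
`u`-derivative of row two equals `t * crossMixedDeriv Φ a b u e`, which vanishes too. Both rows
annihilate `u`, and the determinant is nonzero. -/
theorem eq_zero_or_eq_zero_of_tangent
    (h : ContDiffAt ℝ ∞ (fun z : Plane × Plane => Φ z.1 z.2) (a, b))
    (hev : ∀ᶠ x in 𝓝 a, ContDiffAt ℝ ∞ (fun z : Plane × Plane => Φ z.1 z.2) (x, b))
    (hcin : CinematicCurvature Φ a b) {u v : Plane} (hu : crossDeriv Φ a b u = 0)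
    (hv : inner ℝ (gradY Φ a b) v = 0) (huv : crossMixedDeriv Φ a b u v = 0) :
    u = 0 ∨ v = 0 := by
  by_cases hv0 : v = 0
  · exact Or.inr hv0
  left
  have h0 := hcin.gradient_ne_zero
  set e : Plane := ‖v‖⁻¹ • v with he
  have hvn := norm_ne_zero_iff.2 hv0
  have he1 : ‖e‖ = 1 := by rw [he, norm_smul, norm_inv, norm_norm, inv_mul_cancel₀ hvn]
  have heg : inner ℝ e (gradY Φ a b) = 0 := by
    rw [he, real_inner_comm, inner_smul_right, hv, mul_zero]
  have hue : crossMixedDeriv Φ a b u e = 0 := by rw [he, map_smul, huv, smul_zero]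
  rw [crossMixedDeriv_apply h hev] at hue
  rw [crossDeriv_apply h] at hu
  have hr1 := fderiv_curvatureRowOne h e u
  have hr2 := fderiv_curvatureRowTwo h hev h0 (e := e) (u := u) heg
  have hdet := hcin.det_ne_zero e he1 heg
  have g1 := inner_gradient_eq_fderiv (fun x => curvatureRowOne Φ e x b) u a
  have g2 := inner_gradient_eq_fderiv (fun x => curvatureRowTwo Φ e x b) u a
  rw [Matrix.det_fin_two_of] at hdet
  have hH : ‖gradY Φ a b‖ ≠ 0 := norm_ne_zero_iff.2 h0
  have hH2 := norm_sq_plane (gradY Φ a b)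
  have he2 := norm_sq_plane e
  rw [he1] at he2
  rw [inner_plane] at heg
  set g := gradY Φ a b
  set p := fderiv ℝ (fun x => gradY Φ x b) a u
  set k := fderiv ℝ (gradY Φ a) b e
  set q := fderiv ℝ (fun x => fderiv ℝ (gradY Φ x) b e) a u
  simp only [planeWedge] at hu hue
  obtain ⟨t, ht0, ht1⟩ : ∃ t, g 0 = t * e 1 ∧ g 1 = -(t * e 0) := by
    refine ⟨g 0 * e 1 - g 1 * e 0, ?_, ?_⟩
    · linear_combination g 0 * he2 + e 0 * heg
    · linear_combination g 1 * he2 + e 1 * heg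
  have hg2 : ‖g‖ ^ 2 = t ^ 2 := by
    rw [hH2, ht0, ht1]; linear_combination -t ^ 2 * he2
  have ht : t ≠ 0 := by
    rintro rfl
    apply hH
    simpa using hg2
  rw [ht0, ht1] at hu hue
  have hep : inner ℝ e p = 0 := by
    rw [inner_plane]
    apply mul_left_cancel₀ ht
    linear_combination hu
  have hr2' := hr2 hep
  rw [hep] at hr1
  have hz : fderiv ℝ (fun x => curvatureRowTwo Φ e x b) a u = 0 := by
    apply mul_left_cancel₀ (pow_ne_zero 3 hH)
    rw [hr2', hg2, inner_plane e q, inner_plane e k, inner_plane g p, ht0, ht1, mul_zero]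
    rw [inner_plane] at hep
    linear_combination t * hue + (-t * (k 0 * e 1 - k 1 * e 0)) * hep
      - t * (k 0 * p 1 - k 1 * p 0) * he2
  rw [hr1, inner_plane] at g1
  rw [hz, inner_plane] at g2
  -- Cramer's rule: `g1` and `g2` are the two rows applied to `u`.
  ext i
  fin_cases i
  · apply mul_left_cancel₀ hdet
    simp only [Fin.zero_eta, PiLp.zero_apply, mul_zero]
    linear_combination gradient (fun x => curvatureRowTwo Φ e x b) a 1 * g1
      - gradient (fun x => curvatureRowOne Φ e x b) a 1 * g2
  · apply mul_left_cancel₀ hdet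
    simp only [Fin.mk_one, PiLp.zero_apply, mul_zero]
    linear_combination gradient (fun x => curvatureRowOne Φ e x b) a 0 * g2
      - gradient (fun x => curvatureRowTwo Φ e x b) a 0 * g1

end Nondegeneracy

/-- Uniform estimates for the curves `Φ x y = r` with `x` near `a` and `y` near `b`. Two distinct
centres `x`, `x'` for which `crossGrad` is small compared with `‖x - x'‖` somewhere have at most one
point of tangency, which depends on the data in a quantitative way. -/
structure TangencyBounds (Φ : Plane → Plane → ℝ) (a b : Plane) (M R : ℝ) : Prop where
  one_le : 1 ≤ M
  pos : 0 < R
  le_one : R ≤ 1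
  contDiffAt : ∀ x ∈ ball a R, ∀ y ∈ ball b R,
    ContDiffAt ℝ ∞ (fun z : Plane × Plane => Φ z.1 z.2) (x, y)
  lip : ∀ x ∈ ball a R, ∀ x' ∈ ball a R, ∀ y ∈ ball b R, ∀ y' ∈ ball b R,
    |Φ x y - Φ x' y'| ≤ M * (‖x - x'‖ + ‖y - y'‖)
  mixed : ∀ x ∈ ball a R, ∀ x' ∈ ball a R, ∀ y ∈ ball b R, ∀ y' ∈ ball b R,
    |(Φ x y - Φ x' y) - (Φ x y' - Φ x' y')| ≤ M * (‖x - x'‖ * ‖y - y'‖)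
  cross_lip : ∀ x₀ ∈ ball a R, ∀ x ∈ ball a R, ∀ x' ∈ ball a R, ∀ y ∈ ball b R,
    |crossGrad Φ x₀ x y - crossGrad Φ x₀ x' y| ≤ M * ‖x - x'‖
  normal_lip : ∀ x ∈ ball a R, ∀ x' ∈ ball a R, ∀ y ∈ ball b R, ∀ y' ∈ ball b R,
    ‖unitNormal Φ x y - unitNormal Φ x' y'‖ ≤ M * (‖x - x'‖ + ‖y - y'‖)
  cross_le : ∀ x ∈ ball a R, ∀ x' ∈ ball a R, ∀ y ∈ ball b R,
    |crossGrad Φ x x' y| ≤ M * ‖unitNormal Φ x y - unitNormal Φ x' y‖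
  normal_le : ∀ x ∈ ball a R, ∀ x' ∈ ball a R, ∀ y ∈ ball b R,
    ‖unitNormal Φ x y - unitNormal Φ x' y‖ ≤ M * |crossGrad Φ x x' y|
  inj : ∀ x ∈ ball a R, ∀ x' ∈ ball a R, x ≠ x' → ∀ y₀ ∈ ball b R,
    |crossGrad Φ x x' y₀| ≤ M⁻¹ * ‖x - x'‖ → ∀ y ∈ ball b R, ∀ y' ∈ ball b R,
      ‖x - x'‖ * ‖y - y'‖ ≤
        M * (‖x - x'‖ * |Φ x y - Φ x y'| + |crossGrad Φ x x' y - crossGrad Φ x x' y'|)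
  surj : ∀ x ∈ ball a R, ∀ x' ∈ ball a R, x ≠ x' → ∀ y₀ ∈ ball b R,
    |crossGrad Φ x x' y₀| ≤ M⁻¹ * ‖x - x'‖ → ∀ (y : Plane) (s r c : ℝ),
      0 ≤ s → closedBall y s ⊆ ball b R →
      M * (‖x - x'‖ * |r - Φ x y| + |c - crossGrad Φ x x' y|) ≤ ‖x - x'‖ * s →
      ∃ y' ∈ closedBall y s, Φ x y' = r ∧ crossGrad Φ x x' y' = c
  deriv : ∀ x ∈ ball a R, ∀ x' ∈ ball a R, x ≠ x' → ∀ y₀ ∈ ball b R,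
    |crossGrad Φ x x' y₀| ≤ M⁻¹ * ‖x - x'‖ → ∀ y ∈ ball b R, ∀ v : Plane,
      fderiv ℝ (Φ x) y v = 0 → fderiv ℝ (crossGrad Φ x x') y v = 0 → v = 0

/-! ### Wedge product versus distance of unit normals -/

section PlaneNormals

theorem planeWedge_sq_add_inner_sq (p q : Plane) :
    planeWedge p q ^ 2 + inner ℝ p q ^ 2 = ‖p‖ ^ 2 * ‖q‖ ^ 2 := by
  rw [norm_sq_plane, norm_sq_plane, inner_plane, planeWedge]; ring

/-- With θ the angle between the vectors, this is |sin θ| ≤ 2|sin(θ/2)|, squared. -/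
theorem abs_planeWedge_le_mul_norm_sub {p q : Plane} (hp : p ≠ 0) (hq : q ≠ 0) :
    |planeWedge p q| ≤ ‖p‖ * ‖q‖ * ‖‖p‖⁻¹ • p - ‖q‖⁻¹ • q‖ := by
  have hp' := norm_ne_zero_iff.2 hp
  have hq' := norm_ne_zero_iff.2 hq
  refine abs_le_of_sq_le_sq ?_ (by positivity)
  have h1 : ‖‖p‖⁻¹ • p - ‖q‖⁻¹ • q‖ ^ 2 = 2 - 2 * (inner ℝ p q / (‖p‖ * ‖q‖)) := by
    rw [norm_sub_sq_real, norm_smul, norm_smul, inner_smul_left, inner_smul_right, norm_inv,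
      norm_inv, norm_norm, norm_norm, inv_mul_cancel₀ hp', inv_mul_cancel₀ hq']
    simp only [conj_trivial]
    field_simp
    ring
  have h2 : (‖p‖ * ‖q‖) ^ 2 * (2 - 2 * (inner ℝ p q / (‖p‖ * ‖q‖)))
      = 2 * (‖p‖ * ‖q‖) ^ 2 - 2 * (‖p‖ * ‖q‖) * inner ℝ p q := by
    field_simp
  rw [mul_pow, h1, h2]
  nlinarith [planeWedge_sq_add_inner_sq p q, sq_nonneg (‖p‖ * ‖q‖ - inner ℝ p q)]

/-- For cos θ ≥ 0, 2 − 2 cos θ ≤ 4(1 − cos θ)(1 + cos θ) = 4 sin²θ. The sign condition excludes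
antiparallel vectors, whose wedge is zero. -/
theorem mul_norm_sub_le_abs_planeWedge {p q : Plane} (hp : p ≠ 0) (hq : q ≠ 0)
    (hpq : 0 ≤ inner ℝ p q) :
    ‖p‖ * ‖q‖ * ‖‖p‖⁻¹ • p - ‖q‖⁻¹ • q‖ ≤ 2 * |planeWedge p q| := by
  have hp' := norm_ne_zero_iff.2 hp
  have hq' := norm_ne_zero_iff.2 hq
  refine le_of_sq_le_sq ?_ (by positivity)
  have h1 : ‖‖p‖⁻¹ • p - ‖q‖⁻¹ • q‖ ^ 2 = 2 - 2 * (inner ℝ p q / (‖p‖ * ‖q‖)) := by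
    rw [norm_sub_sq_real, norm_smul, norm_smul, inner_smul_left, inner_smul_right, norm_inv,
      norm_inv, norm_norm, norm_norm, inv_mul_cancel₀ hp', inv_mul_cancel₀ hq']
    simp only [conj_trivial]
    field_simp
    ring
  have h2 : (‖p‖ * ‖q‖) ^ 2 * (2 - 2 * (inner ℝ p q / (‖p‖ * ‖q‖)))
      = 2 * (‖p‖ * ‖q‖) ^ 2 - 2 * (‖p‖ * ‖q‖) * inner ℝ p q := by
    field_simp
  rw [mul_pow, h1, h2, mul_pow 2, sq_abs]
  have h3 := real_inner_le_norm p q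
  nlinarith [planeWedge_sq_add_inner_sq p q, mul_nonneg hpq (sub_nonneg.2 h3),
    mul_nonneg (mul_nonneg (norm_nonneg p) (norm_nonneg q)) (sub_nonneg.2 h3)]

end PlaneNormals

/-! ### Uniform estimates near the base point -/

section Bounds

variable {Φ : Plane → Plane → ℝ} {a b : Plane}

/-- The right side is continuous, homogeneous of degree one in each of `u` and `v`, and positive on
the product of unit spheres by the nondegeneracy lemma; `c` is its minimum there. -/
theorem exists_tangent_lower_bound
    (h : ContDiffAt ℝ ∞ (fun z : Plane × Plane => Φ z.1 z.2) (a, b))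
    (hev : ∀ᶠ x in 𝓝 a, ContDiffAt ℝ ∞ (fun z : Plane × Plane => Φ z.1 z.2) (x, b))
    (hcin : CinematicCurvature Φ a b) :
    ∃ c : ℝ, 0 < c ∧ ∀ u v : Plane, c * (‖u‖ * ‖v‖) ≤
      |crossDeriv Φ a b u| * ‖v‖ + ‖u‖ * |inner ℝ (gradY Φ a b) v|
        + |crossMixedDeriv Φ a b u v| := by
  let T : Plane × Plane → ℝ := fun z => |crossDeriv Φ a b z.1| * ‖z.2‖
    + ‖z.1‖ * |inner ℝ (gradY Φ a b) z.2| + |crossMixedDeriv Φ a b z.1 z.2|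
  have hT : Continuous T := by fun_prop
  have hcomp : IsCompact (sphere (0 : Plane) 1 ×ˢ sphere (0 : Plane) 1) :=
    (isCompact_sphere _ _).prod (isCompact_sphere _ _)
  have hne : (sphere (0 : Plane) 1 ×ˢ sphere (0 : Plane) 1).Nonempty :=
    (NormedSpace.sphere_nonempty.2 zero_le_one).prod (NormedSpace.sphere_nonempty.2 zero_le_one)
  obtain ⟨⟨u₀, v₀⟩, h0, hmin⟩ := hcomp.exists_isMinOn hne hT.continuousOn
  have hu₀ : ‖u₀‖ = 1 := by simpa using h0.1
  have hv₀ : ‖v₀‖ = 1 := by simpa using h0.2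
  refine ⟨T (u₀, v₀), ?_, ?_⟩
  · refine lt_of_le_of_ne (by positivity) fun hzero => ?_
    simp only [T, hu₀, hv₀, mul_one, one_mul] at hzero
    have h1 := abs_nonneg (crossDeriv Φ a b u₀)
    have h2 := abs_nonneg (inner ℝ (gradY Φ a b) v₀)
    have h3 := abs_nonneg (crossMixedDeriv Φ a b u₀ v₀)
    rcases eq_zero_or_eq_zero_of_tangent h hev hcin (u := u₀) (v := v₀)
      (abs_eq_zero.1 (by linarith)) (abs_eq_zero.1 (by linarith))
      (abs_eq_zero.1 (by linarith)) with h4 | h4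
    · simp [h4] at hu₀
    · simp [h4] at hv₀
  · intro u v
    rcases eq_or_ne u 0 with rfl | hu
    · simp
    rcases eq_or_ne v 0 with rfl | hv
    · simp
    have hu' := norm_pos_iff.2 hu
    have hv' := norm_pos_iff.2 hv
    have h1 : T (u₀, v₀) ≤ T (‖u‖⁻¹ • u, ‖v‖⁻¹ • v) := hmin
      ⟨by simp [norm_smul, hu'.ne'], by simp [norm_smul, hv'.ne']⟩
    have h2 : T (‖u‖⁻¹ • u, ‖v‖⁻¹ • v) * (‖u‖ * ‖v‖) = T (u, v) := by
      simp only [T, map_smul, smul_apply, smul_eq_mul, inner_smul_right, abs_mul,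
        norm_smul, abs_inv, abs_norm, norm_inv, norm_norm]
      field_simp
    calc T (u₀, v₀) * (‖u‖ * ‖v‖) ≤ T (‖u‖⁻¹ • u, ‖v‖⁻¹ • v) * (‖u‖ * ‖v‖) := by gcongr
      _ = _ := h2

theorem ball_prod_mem {E F : Type*} [PseudoMetricSpace E] [PseudoMetricSpace F] {x a : E} {y b : F}
    {R : ℝ} (hx : x ∈ ball a R) (hy : y ∈ ball b R) : (x, y) ∈ ball (a, b) R := by
  rw [← ball_prod_same]; exact ⟨hx, hy⟩

theorem eventually_forall_ball {E F : Type*} [PseudoMetricSpace E] [PseudoMetricSpace F] {a : E}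
    {b : F} {p : E × F → Prop} (h : ∀ᶠ z in 𝓝 (a, b), p z) :
    ∀ᶠ R in 𝓝[>] (0 : ℝ), ∀ x ∈ ball a R, ∀ y ∈ ball b R, p (x, y) := by
  filter_upwards [(eventually_ball_subset h).filter_mono nhdsWithin_le_nhds] with R hR x hx y hy
  exact hR (ball_prod_mem hx hy)

variable (h : ∀ᶠ z in 𝓝 (a, b), ContDiffAt ℝ ∞ (fun z : Plane × Plane => Φ z.1 z.2) z)
include h

/-- Mean value inequality in `y` for `Φ x - Φ x'`, whose derivative is O(|x − x'|). This product
bound is what keeps changes of radius linear in the tangency gap. -/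
theorem eventually_mixed :
    ∀ᶠ M in atTop, ∀ᶠ R in 𝓝[>] (0 : ℝ),
      ∀ x ∈ ball a R, ∀ x' ∈ ball a R, ∀ y ∈ ball b R, ∀ y' ∈ ball b R,
        |(Φ x y - Φ x' y) - (Φ x y' - Φ x' y')| ≤ M * (‖x - x'‖ * ‖y - y'‖) := by
  filter_upwards [h.self_of_nhds.partial_fderiv.eventually_lipschitz] with M hM
  filter_upwards [hM, eventually_forall_ball h] with R hR hs x hx x' hx' y hy y' hy'
  have hd : ∀ x ∈ ball a R, ∀ y ∈ ball b R, HasFDerivAt (Φ x) (fderiv ℝ (Φ x) y) y :=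
    fun x hx y hy => ((contDiffAt_slice (hs x hx y hy)).differentiableAt (by simp)).hasFDerivAt
  have := (convex_ball b R).norm_image_sub_le_of_norm_hasFDerivWithin_le
    (f := fun y => Φ x y - Φ x' y) (C := M * ‖x - x'‖)
    (fun y hy => ((hd x hx y hy).sub (hd x' hx' y hy)).hasFDerivWithinAt)
    (fun y hy => by simpa using hR x hx x' hx' y hy y hy) hy' hy
  rwa [Real.norm_eq_abs, mul_assoc] at this

theorem eventually_crossGrad_contDiffAt : ∀ᶠ R in 𝓝[>] (0 : ℝ),
      ∀ x ∈ ball a R, ∀ x' ∈ ball a R, ∀ y ∈ ball b R,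
        ContDiffAt ℝ ∞ (fun z : (Plane × Plane) × Plane => crossGrad Φ z.1.1 z.1.2 z.2)
          ((x, x'), y) := by
  filter_upwards [eventually_forall_ball h] with R hR x hx x' hx' y hy
  exact contDiffAt_crossGrad (hR x hx y hy) (hR x' hx' y hy)

theorem eventually_crossGrad_approx {c : ℝ} (hc : 0 < c) : ∀ᶠ R in 𝓝[>] (0 : ℝ),
      ∀ x ∈ ball a R, ∀ x' ∈ ball a R, ∀ y ∈ ball b R,
        |crossGrad Φ x x' y - crossDeriv Φ a b (x' - x)| ≤ c * ‖x - x'‖ := by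
  have h0 := h.self_of_nhds
  filter_upwards [(contDiffAt_crossGrad h0 h0).eventually_approx hc] with R hR x hx x' hx' y hy
  -- Comparison with the diagonal point `(x, x)`, where the wedge vanishes, makes the error
  -- proportional to |x − x'|.
  have := hR (x, x') (ball_prod_mem hx hx') (x, x) (ball_prod_mem hx hx) y hy y hy
  simpa [crossGrad_self, crossDeriv, Prod.norm_mk, norm_sub_rev] using this

theorem eventually_crossGrad_mixed_approx {c : ℝ} (hc : 0 < c) : ∀ᶠ R in 𝓝[>] (0 : ℝ),
      ∀ x ∈ ball a R, ∀ x' ∈ ball a R, ∀ y ∈ ball b R, ∀ y' ∈ ball b R,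
        |crossGrad Φ x x' y - crossGrad Φ x x' y' - crossMixedDeriv Φ a b (x' - x) (y - y')|
          ≤ c * (‖x - x'‖ * ‖y - y'‖) := by
  have h0 := h.self_of_nhds
  have h1 := ContDiffAt.partial_fderiv (f := fun z : Plane × Plane => crossGrad Φ z.1 z.2)
    (contDiffAt_crossGrad h0 h0)
  filter_upwards [h1.eventually_approx hc, eventually_crossGrad_contDiffAt h]
    with R hR hs x hx x' hx' y hy y' hy'
  have hd : ∀ y ∈ ball b R,
      HasFDerivAt (crossGrad Φ x x') (fderiv ℝ (crossGrad Φ x x') y) y := fun y hy =>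
    (((hs x hx x' hx' y hy).comp (f := fun y : Plane => ((x, x'), y)) y
        (contDiffAt_const.prodMk contDiffAt_id)).differentiableAt (by simp)).hasFDerivAt
  have hself : crossGrad Φ x x = fun _ => 0 := funext fun y => crossGrad_self Φ x y
  -- Mean value inequality in `y`; the deviation of the `y`-derivative is O(|x − x'|) because that
  -- derivative vanishes at the diagonal point `(x, x)`.
  have := (convex_ball b R).norm_image_sub_le_of_norm_hasFDerivWithin_le'
    (f := crossGrad Φ x x') (φ := crossMixedDeriv Φ a b (x' - x)) (C := c * ‖x - x'‖)
    (fun y hy => (hd y hy).hasFDerivWithinAt)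
    (fun y hy => by
      have := hR (x, x') (ball_prod_mem hx hx') (x, x) (ball_prod_mem hx hx) y hy y hy
      simpa [hself, crossMixedDeriv, Prod.norm_mk, norm_sub_rev] using this) hy' hy
  rwa [Real.norm_eq_abs, mul_assoc] at this

theorem eventually_inner_approx {c : ℝ} (hc : 0 < c) : ∀ᶠ R in 𝓝[>] (0 : ℝ),
      ∀ x ∈ ball a R, ∀ y ∈ ball b R, ∀ y' ∈ ball b R,
        |Φ x y - Φ x y' - inner ℝ (gradY Φ a b) (y - y')| ≤ c * ‖y - y'‖ := by
  have h0 := h.self_of_nhds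
  have h1 : HasFDerivAt (Φ a) (fderiv ℝ (fun z : Plane × Plane => Φ z.1 z.2) (a, b) ∘L
      .inr ℝ Plane Plane) b :=
    ((h0.differentiableAt (by simp)).hasFDerivAt).comp b (hasFDerivAt_prodMk_right a b)
  filter_upwards [h0.eventually_approx hc] with R hR x hx y hy y' hy'
  have := hR x hx x hx y hy y' hy'
  rw [real_inner_comm, gradY, inner_gradient_eq_fderiv, h1.fderiv]
  simpa using this

theorem eventually_unitNormal_bounds (h0 : gradY Φ a b ≠ 0) :
    ∀ᶠ M in atTop, ∀ᶠ R in 𝓝[>] (0 : ℝ), ∀ x ∈ ball a R, ∀ x' ∈ ball a R, ∀ y ∈ ball b R,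
      |crossGrad Φ x x' y| ≤ M * ‖unitNormal Φ x y - unitNormal Φ x' y‖ ∧
      ‖unitNormal Φ x y - unitNormal Φ x' y‖ ≤ M * |crossGrad Φ x x' y| := by
  have hg := (contDiffAt_gradY h.self_of_nhds).continuousAt
  have hH := norm_pos_iff.2 h0
  have g1 : ContinuousAt (fun z : (Plane × Plane) × Plane => gradY Φ z.1.1 z.2) ((a, a), b) :=
    ContinuousAt.comp (g := fun z : Plane × Plane => gradY Φ z.1 z.2)
      (f := fun z : (Plane × Plane) × Plane => (z.1.1, z.2)) hg (by fun_prop)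
  have g2 : ContinuousAt (fun z : (Plane × Plane) × Plane => gradY Φ z.1.2 z.2) ((a, a), b) :=
    ContinuousAt.comp (g := fun z : Plane × Plane => gradY Φ z.1 z.2)
      (f := fun z : (Plane × Plane) × Plane => (z.1.2, z.2)) hg (by fun_prop)
  have e1 := (Filter.Tendsto.inner (𝕜 := ℝ) g1 g2).eventually_const_lt (u := 0)
    (by rw [real_inner_self_eq_norm_sq]; positivity)
  have e2 := (g1.norm.mul g2.norm).eventually_const_lt
    (u := ‖gradY Φ a b‖ * ‖gradY Φ a b‖ / 2) (half_lt_self (by positivity))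
  have e3 := (g1.norm.mul g2.norm).eventually_lt_const
    (u := ‖gradY Φ a b‖ * ‖gradY Φ a b‖ * 2) (lt_mul_of_one_lt_right (by positivity) one_lt_two)
  filter_upwards [eventually_ge_atTop (‖gradY Φ a b‖ * ‖gradY Φ a b‖ * 2),
    eventually_ge_atTop (4 / (‖gradY Φ a b‖ * ‖gradY Φ a b‖))] with M hM1 hM2
  filter_upwards [eventually_forall_ball (e1.and (e2.and e3))] with R hR x hx x' hx' y hy
  obtain ⟨k1, k2, k3⟩ := hR (x, x') (ball_prod_mem hx hx') y hy
  simp only at k1 k2 k3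
  have hp : gradY Φ x y ≠ 0 := by rintro hp; simp [hp] at k1
  have hq : gradY Φ x' y ≠ 0 := by rintro hp; simp [hp] at k1
  have w1 := abs_planeWedge_le_mul_norm_sub hp hq
  have w2 := mul_norm_sub_le_abs_planeWedge hp hq k1.le
  refine ⟨w1.trans (mul_le_mul_of_nonneg_right (k3.le.trans hM1) (norm_nonneg _)), ?_⟩
  rw [div_le_iff₀ (by positivity)] at hM2
  have w3 : (‖gradY Φ a b‖ * ‖gradY Φ a b‖ / 2) * ‖unitNormal Φ x y - unitNormal Φ x' y‖
      ≤ 2 * |crossGrad Φ x x' y| :=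
    (mul_le_mul_of_nonneg_right k2.le (norm_nonneg _)).trans w2
  have hM0 : 0 < M := lt_of_lt_of_le (by positivity) hM1
  set n := ‖unitNormal Φ x y - unitNormal Φ x' y‖
  have hn : 0 ≤ n := norm_nonneg _
  nlinarith [mul_le_mul_of_nonneg_right hM2 hn, mul_le_mul_of_nonneg_left w3 hM0.le]

end Bounds

theorem eventually_tangencyBounds {Φ : Plane → Plane → ℝ} {a b : Plane}
    (h : ∀ᶠ z in 𝓝 (a, b), ContDiffAt ℝ ∞ (fun z : Plane × Plane => Φ z.1 z.2) z)
    (hcin : CinematicCurvature Φ a b) :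
    ∀ᶠ M in atTop, ∀ᶠ R in 𝓝[>] (0 : ℝ), TangencyBounds Φ a b M R := by
  have h0 := h.self_of_nhds
  have hev : ∀ᶠ x in 𝓝 a, ContDiffAt ℝ ∞ (fun z : Plane × Plane => Φ z.1 z.2) (x, b) :=
    (Continuous.prodMk_left b).continuousAt.eventually h
  obtain ⟨c, hc, hlow⟩ := exists_tangent_lower_bound h0 hev hcin
  filter_upwards [eventually_ge_atTop 1, eventually_ge_atTop (8 / c), h0.eventually_lipschitz,
    eventually_mixed h, (contDiffAt_crossGrad h0 h0).eventually_lipschitz,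
    (contDiffAt_unitNormal h0 hcin.gradient_ne_zero).eventually_lipschitz,
    eventually_unitNormal_bounds h hcin.gradient_ne_zero] with M hM1 hMc k1 k2 k3 k4 k5
  have hc8 : 0 < c / 8 := by positivity
  filter_upwards [Ioc_mem_nhdsGT zero_lt_one, k1, k2, k3, k4, k5, eventually_forall_ball h,
    eventually_crossGrad_contDiffAt h, eventually_crossGrad_approx h hc8,
    eventually_crossGrad_mixed_approx h hc8, eventually_inner_approx h hc8]
    with R hR k1 k2 k3 k4 k5 hs hsG a1 a2 a3
  have hM0 : 0 < M := by linarith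
  have hMc' : M⁻¹ ≤ c / 8 := by
    rw [div_le_iff₀ hc] at hMc
    rw [inv_le_iff_one_le_mul₀ hM0]
    linarith
  have hM8 : 1 ≤ M * (c / 8) := by rwa [inv_le_iff_one_le_mul₀ hM0, mul_comm] at hMc'
  -- The factor |x − x'| in the first component puts both components on the same scale; `L` is the
  -- linear model, the same for all `y`.
  let P : Plane → Plane → Plane → ℝ × ℝ := fun x x' y => (‖x - x'‖ * Φ x y, crossGrad Φ x x' y)
  let L : Plane → Plane → Plane →L[ℝ] ℝ × ℝ := fun x x' =>
    (‖x - x'‖ • innerSL ℝ (gradY Φ a b)).prod (crossMixedDeriv Φ a b (x' - x))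
  have hL : ∀ x ∈ ball a R, ∀ x' ∈ ball a R, ∀ y₀ ∈ ball b R,
      |crossGrad Φ x x' y₀| ≤ M⁻¹ * ‖x - x'‖ →
      ∀ v, c / 4 * ‖x - x'‖ * ‖v‖ ≤ ‖L x x' v‖ := by
    intro x hx x' hx' y₀ hy₀ ht v
    have e1 := a1 x hx x' hx' y₀ hy₀
    have e2 := hlow (x' - x) v
    rw [norm_sub_rev x' x] at e2
    -- Smallness of the wedge at the one point `y₀` controls this `y`-independent term, which is
    -- then absorbed into the lower bound `hlow`.
    have e3 : |crossDeriv Φ a b (x' - x)| ≤ c / 2 * ‖x - x'‖ := by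
      have e4 := abs_sub_abs_le_abs_sub (crossDeriv Φ a b (x' - x)) (crossGrad Φ x x' y₀)
      rw [abs_sub_comm] at e4
      have e5 := mul_le_mul_of_nonneg_right hMc' (norm_nonneg (x - x'))
      linarith [mul_nonneg hc.le (norm_nonneg (x - x'))]
    have e6 := mul_le_mul_of_nonneg_right e3 (norm_nonneg v)
    have e7 : ‖x - x'‖ * |inner ℝ (gradY Φ a b) v| ≤ ‖L x x' v‖ := by
      simp [L]
    have e8 : |crossMixedDeriv Φ a b (x' - x) v| ≤ ‖L x x' v‖ := norm_snd_le (L x x' v)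
    nlinarith
  have hP : ∀ x ∈ ball a R, ∀ x' ∈ ball a R, ∀ y ∈ ball b R, ∀ y' ∈ ball b R,
      ‖P x x' y - P x x' y' - L x x' (y - y')‖ ≤ c / 4 * ‖x - x'‖ / 2 * ‖y - y'‖ := by
    intro x hx x' hx' y hy y' hy'
    refine max_le ?_ ?_
    · have := mul_le_mul_of_nonneg_left (a3 x hx y hy y' hy') (norm_nonneg (x - x'))
      rw [← abs_norm (x - x'), ← abs_mul, abs_norm] at this
      simp only [P, L, Prod.fst_sub, ContinuousLinearMap.prod_apply, Real.norm_eq_abs]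
      simp only [smul_apply, innerSL_apply_apply, smul_eq_mul]
      convert! this using 1
      · congr 1; ring
      · ring
    · have := a2 x hx x' hx' y hy y' hy'
      convert! this using 1
      ring
  have hm : ∀ {x x' : Plane}, x ≠ x' → 0 < c / 4 * ‖x - x'‖ := fun hne => by
    have := norm_pos_iff.2 (sub_ne_zero.2 hne)
    positivity
  refine ⟨hM1, hR.1, hR.2, hs, k1, k2, ?_, k4, fun x hx x' hx' y hy => (k5 x hx x' hx' y hy).1,
    fun x hx x' hx' y hy => (k5 x hx x' hx' y hy).2, ?_, ?_, ?_⟩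
  · intro x₀ hx₀ x hx x' hx' y hy
    have := k3 (x₀, x) (ball_prod_mem hx₀ hx) (x₀, x') (ball_prod_mem hx₀ hx') y hy y hy
    simpa [Prod.norm_mk] using this
  · intro x hx x' hx' hne y₀ hy₀ ht y hy y' hy'
    have e1 := half_norm_sub_le_norm_image_sub (hL x hx x' hx' y₀ hy₀ ht) (hP x hx x' hx') hy hy'
    have e2 : ‖P x x' y - P x x' y'‖
        ≤ ‖x - x'‖ * |Φ x y - Φ x y'| + |crossGrad Φ x x' y - crossGrad Φ x x' y'| := by
      refine max_le ?_ ?_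
      · simp only [P, Prod.fst_sub, Real.norm_eq_abs, ← mul_sub, abs_mul, abs_norm]
        exact le_add_of_nonneg_right (abs_nonneg _)
      · exact le_add_of_nonneg_left (by positivity)
    calc ‖x - x'‖ * ‖y - y'‖ ≤ M * (c / 8) * (‖x - x'‖ * ‖y - y'‖) :=
          le_mul_of_one_le_left (by positivity) hM8
      _ = M * (c / 4 * ‖x - x'‖ / 2 * ‖y - y'‖) := by ring
      _ ≤ _ := mul_le_mul_of_nonneg_left (e1.trans e2) hM0.le
  · intro x hx x' hx' hne y₀ hy₀ ht y s r k hs0 hys hle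
    have hx0 := norm_pos_iff.2 (sub_ne_zero.2 hne)
    have e2 : ‖((‖x - x'‖ * r, k) : ℝ × ℝ) - P x x' y‖
        ≤ ‖x - x'‖ * |r - Φ x y| + |k - crossGrad Φ x x' y| := by
      refine max_le ?_ ?_
      · simp only [P, Prod.fst_sub, Real.norm_eq_abs, ← mul_sub, abs_mul, abs_norm]
        exact le_add_of_nonneg_right (abs_nonneg _)
      · exact le_add_of_nonneg_left (by positivity)
    obtain ⟨y', hy', heq⟩ := exists_mem_closedBall_eq (f := P x x') (z := (‖x - x'‖ * r, k))
      (by simp) (hm hne) (hL x hx x' hx' y₀ hy₀ ht) (hP x hx x' hx') hs0 hys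
      (e2.trans (by
        have : M * (‖x - x'‖ * |r - Φ x y| + |k - crossGrad Φ x x' y|)
            ≤ M * (c / 4 * ‖x - x'‖ / 2 * s) := by
          refine hle.trans ?_
          calc ‖x - x'‖ * s ≤ M * (c / 8) * (‖x - x'‖ * s) :=
                le_mul_of_one_le_left (by positivity) hM8
            _ = _ := by ring
        exact le_of_mul_le_mul_left this hM0))
    refine ⟨y', hy', ?_, congrArg Prod.snd heq⟩
    exact mul_left_cancel₀ hx0.ne' (congrArg Prod.fst heq)
  · intro x hx x' hx' hne y₀ hy₀ ht y hy v hv1 hv2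
    have d1 : HasFDerivAt (Φ x) (fderiv ℝ (Φ x) y) y :=
      ((contDiffAt_slice (hs x hx y hy)).differentiableAt (by simp)).hasFDerivAt
    have d2 : HasFDerivAt (crossGrad Φ x x') (fderiv ℝ (crossGrad Φ x x') y) y :=
      (((hsG x hx x' hx' y hy).comp (f := fun y : Plane => ((x, x'), y)) y
        (contDiffAt_const.prodMk contDiffAt_id)).differentiableAt (by simp)).hasFDerivAt
    refine eq_zero_of_fderiv_eq_zero (f := P x x') (hm hne) (hL x hx x' hx' y₀ hy₀ ht)
      (hP x hx x' hx') (isOpen_ball.mem_nhds hy) ((d1.const_mul ‖x - x'‖).prodMk d2) ?_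
    simp [hv1, hv2]

/-! ### Perturbation of tangencies -/

namespace TangencyBounds

variable {Φ : Plane → Plane → ℝ} {a b : Plane} {M R : ℝ} (T : TangencyBounds Φ a b M R)
include T

theorem pow_mul_le {i : ℕ} (hi : i ≤ 4) {X : ℝ} (hX : 0 ≤ X) : M ^ i * X ≤ M ^ 4 * X :=
  mul_le_mul_of_nonneg_right (pow_le_pow_right₀ T.one_le hi) hX

theorem norm_sub_lt_two {x x' : Plane} (hx : x ∈ ball a R) (hx' : x' ∈ ball a R) :
    ‖x - x'‖ < 2 := by
  have h1 := dist_triangle_right x x' a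
  rw [mem_ball] at hx hx'
  rw [← dist_eq_norm]
  linarith [T.le_one]

theorem abs_crossGrad_le_gap {x x' y y' : Plane} (hx : x ∈ ball a R) (hx' : x' ∈ ball a R)
    (hy : y ∈ ball b R) (hy' : y' ∈ ball b R) :
    |crossGrad Φ x x' y|
      ≤ 2 * M ^ 2 * (‖y - y'‖ + ‖unitNormal Φ x y - unitNormal Φ x' y'‖) := by
  have hM := T.one_le
  have h1 := T.cross_le x hx x' hx' y hy
  have h2 := T.normal_lip x' hx' x' hx' y' hy' y hy
  have h3 := norm_sub_le_norm_sub_add_norm_sub (unitNormal Φ x y) (unitNormal Φ x' y')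
    (unitNormal Φ x' y)
  rw [sub_self, norm_zero, zero_add, norm_sub_rev y'] at h2
  have h4 : 0 ≤ ‖unitNormal Φ x y - unitNormal Φ x' y'‖ := norm_nonneg _
  have h5 : 0 ≤ ‖y - y'‖ := norm_nonneg _
  calc |crossGrad Φ x x' y|
      ≤ M * (‖unitNormal Φ x y - unitNormal Φ x' y'‖ + M * ‖y - y'‖) :=
        h1.trans (by gcongr; linarith)
    _ ≤ M * (M * ‖unitNormal Φ x y - unitNormal Φ x' y'‖ + M * ‖y - y'‖) := by
        gcongr; exact le_mul_of_one_le_left h4 hM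
    _ = M ^ 2 * (‖y - y'‖ + ‖unitNormal Φ x y - unitNormal Φ x' y'‖) := by ring
    _ ≤ _ := by gcongr; nlinarith

/-- Near-tangency of two curves can be turned into exact (perturbed) tangency by moving the
radius of the second one. -/
theorem exists_perturbed_tangency {x₀ x₁ y y₁ : Plane} {r₀ r₁ γ α K d W : ℝ} {w₀ w₁ w₂ : ℝ}
    (hx₀ : x₀ ∈ ball a R) (hx₁ : x₁ ∈ ball a R) (hγ : γ < α) (hα : α ≤ R)
    (hK : 20 * M ^ 4 ≤ K) (hKγ : 20 * M ^ 4 ≤ K * (α - γ))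
    (hy : y ∈ closedBall b γ) (hy₁ : y₁ ∈ closedBall b γ) (hr₀ : Φ x₀ y = r₀) (hr₁ : Φ x₁ y₁ = r₁)
    (hd : ‖y - y₁‖ + ‖unitNormal Φ x₀ y - unitNormal Φ x₁ y₁‖ = d)
    (hKd : K * d < ‖x₀ - x₁‖) (hW₀ : |w₀| ≤ W) (hW₁ : |w₁| ≤ W) (hW₂ : |w₂| ≤ W)
    (hKW : K * W ≤ ‖x₀ - x₁‖) :
    ∃ y' ∈ ball b α, Φ x₀ y' - r₀ = w₀ ∧ crossGrad Φ x₀ x₁ y' = w₂ ∧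
      |Φ x₁ y' - w₁ - r₁| ≤ K * (d + W) := by
  have hM := T.one_le
  have hM0 : 0 < M := by linarith
  have hd0 : 0 ≤ d := hd ▸ by positivity
  have hW : 0 ≤ W := (abs_nonneg _).trans hW₀
  have hyR : y ∈ ball b R := closedBall_subset_ball (hγ.trans_le hα) hy
  have hy₁R : y₁ ∈ ball b R := closedBall_subset_ball (hγ.trans_le hα) hy₁
  have hG := T.abs_crossGrad_le_gap hx₀ hx₁ hyR hy₁R
  rw [hd] at hG
  have hlam2 := T.norm_sub_lt_two hx₀ hx₁
  set l := ‖x₀ - x₁‖ with hl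
  have hl0 : 0 < l := lt_of_le_of_lt (mul_nonneg (le_trans (by positivity) hK) hd0) hKd
  have hne : x₀ ≠ x₁ := by
    rintro rfl
    simp [hl] at hl0
  have b1 : 20 * (M ^ 4 * d) ≤ l := by
    linarith [mul_le_mul_of_nonneg_right hK hd0]
  have hDβ : 10 * (M ^ 4 * (d + W)) ≤ (α - γ) * l := by
    have e1 := mul_le_mul_of_nonneg_right hKγ (add_nonneg hd0 hW)
    have e2 := mul_le_mul_of_nonneg_left (hKd.le) (sub_pos.2 hγ).le
    have e3 := mul_le_mul_of_nonneg_left hKW (sub_pos.2 hγ).le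
    linarith
  have p0 := fun {i : ℕ} (hi : i ≤ 4) => T.pow_mul_le hi hd0
  have q0 := fun {i : ℕ} (hi : i ≤ 4) => T.pow_mul_le hi hW
  have htan : |crossGrad Φ x₀ x₁ y| ≤ M⁻¹ * l := by
    rw [le_inv_mul_iff₀ hM0]
    have := mul_le_mul_of_nonneg_left hG hM0.le
    linarith [p0 (i := 3) (by norm_num), mul_nonneg (pow_pos hM0 4).le hd0]
  set s := 4 * M ^ 3 * (d + W) / l with hs
  have hs0 : 0 ≤ s := by positivity
  have hls : l * s = 4 * M ^ 3 * (d + W) := by rw [hs]; field_simp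
  have hsβ : s < α - γ := by
    by_contra! hcon
    have e1 := mul_le_mul_of_nonneg_left hcon hl0.le
    have e2 : 0 < l * (α - γ) := mul_pos hl0 (sub_pos.2 hγ)
    have e3 := p0 (i := 3) (by norm_num)
    have e4 := q0 (i := 3) (by norm_num)
    linarith
  have hball : closedBall y s ⊆ ball b α := by
    refine closedBall_subset_ball' ?_
    rw [mem_closedBall] at hy
    linarith
  obtain ⟨y', hy', h1, h2⟩ := T.surj x₀ hx₀ x₁ hx₁ hne y hyR htan y s (r₀ + w₀) w₂ hs0
    (hball.trans (ball_subset_ball hα)) (by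
      have e1 : |r₀ + w₀ - Φ x₀ y| ≤ W := by rw [hr₀, add_sub_cancel_left]; exact hW₀
      have e2 : |w₂ - crossGrad Φ x₀ x₁ y| ≤ W + 2 * M ^ 2 * d :=
        (abs_sub _ _).trans (add_le_add hW₂ hG)
      have e3 : l * |r₀ + w₀ - Φ x₀ y| ≤ 2 * W :=
        mul_le_mul hlam2.le e1 (abs_nonneg _) zero_le_two
      have e4 : M * (l * |r₀ + w₀ - Φ x₀ y| + |w₂ - crossGrad Φ x₀ x₁ y|)
          ≤ M * (2 * W + (W + 2 * M ^ 2 * d)) :=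
        mul_le_mul_of_nonneg_left (add_le_add e3 e2) hM0.le
      have e5 : M * W ≤ M ^ 3 * W :=
        mul_le_mul_of_nonneg_right (le_self_pow₀ hM (by norm_num)) hW
      rw [hls]
      linarith [mul_nonneg (pow_pos hM0 3).le hd0, mul_nonneg (pow_pos hM0 3).le hW])
  refine ⟨y', hball hy', by rw [h1]; ring, h2, ?_⟩
  have hy'R := ball_subset_ball hα (hball hy')
  -- The change of Φ(x₁,·) from `y` to `y'` is that of Φ(x₀,·), which is `w₀`, up to M·l·s. The
  -- factor `l` cancels the denominator of `s`.
  have m1 := T.mixed x₁ hx₁ x₀ hx₀ y' hy'R y hyR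
  have m2 := T.lip x₁ hx₁ x₁ hx₁ y hyR y₁ hy₁R
  rw [norm_sub_rev x₁ x₀, ← hl] at m1
  rw [sub_self, norm_zero, zero_add] at m2
  have m3 : M * (l * ‖y' - y‖) ≤ 4 * (M ^ 4 * (d + W)) := by
    rw [mem_closedBall, dist_eq_norm] at hy'
    calc M * (l * ‖y' - y‖) ≤ M * (l * s) := by gcongr
      _ = _ := by rw [hls]; ring
  have m4 : M * ‖y - y₁‖ ≤ M ^ 4 * d := by
    have : ‖y - y₁‖ ≤ d := by rw [← hd]; exact le_add_of_nonneg_right (norm_nonneg _)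
    calc M * ‖y - y₁‖ ≤ M * d := by gcongr
      _ = M ^ 1 * d := by ring
      _ ≤ _ := p0 (by norm_num)
  have m5 : W ≤ M ^ 4 * W := by simpa using q0 (i := 0) (by norm_num)
  have m6 := mul_le_mul_of_nonneg_right hK (add_nonneg hd0 hW)
  have m7 := mul_nonneg (pow_pos hM0 4).le hd0
  rw [abs_le] at m1 m2 hW₀ hW₁
  rw [hr₀] at m1
  rw [hr₁] at m2
  exact abs_le.2 ⟨by linarith, by linarith⟩

/-- If two curves are nearly tangent at a point of a ball, and the second one is close to a curve
which is (up to a perturbation) tangent to the first one in a larger ball, then the two curves are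
correspondingly close to tangency in the larger ball. -/
theorem exists_near_tangency {x₀ x₁ x y y₁ z : Plane} {r₀ r₁ r γ α K d W : ℝ} {w₀ w₁ w₂ : ℝ}
    (hx₀ : x₀ ∈ ball a R) (hx₁ : x₁ ∈ ball a R) (hx : x ∈ ball a R) (hγ : γ < α) (hα : α ≤ R)
    (hK : 20 * M ^ 4 ≤ K) (hKγ : 20 * M ^ 4 ≤ K * (α - γ))
    (hy : y ∈ closedBall b γ) (hy₁ : y₁ ∈ closedBall b γ) (hr₀ : Φ x₀ y = r₀)
    (hd : ‖y - y₁‖ + ‖unitNormal Φ x₀ y - unitNormal Φ x₁ y₁‖ = d)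
    (hKd : K * d < ‖x₀ - x₁‖) (hW₀ : |w₀| ≤ W) (hW₁ : |w₁| ≤ W) (hW₂ : |w₂| ≤ W)
    (hz : z ∈ ball b α) (hz₀ : Φ x₀ z - r₀ = w₀) (hz₁ : Φ x z - r = w₁)
    (hz₂ : crossGrad Φ x₀ x z = w₂)
    (hs : K * (‖x - x₁‖ + |r - r₁| + W) < ‖x₀ - x₁‖) :
    ∃ z₀ ∈ ball b α, ∃ z₁ ∈ ball b α, Φ x₀ z₀ = r₀ ∧ Φ x₁ z₁ = r₁ ∧
      ‖z₀ - z₁‖ + ‖unitNormal Φ x₀ z₀ - unitNormal Φ x₁ z₁‖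
        ≤ K * (‖x - x₁‖ + |r - r₁| + W) := by
  have hM := T.one_le
  have hM0 : 0 < M := by linarith
  have hd0 : 0 ≤ d := hd ▸ by positivity
  have hW : 0 ≤ W := (abs_nonneg _).trans hW₀
  have hβ := sub_pos.2 hγ
  have hyR : y ∈ ball b R := closedBall_subset_ball (hγ.trans_le hα) hy
  have hy₁R : y₁ ∈ ball b R := closedBall_subset_ball (hγ.trans_le hα) hy₁
  have hzR : z ∈ ball b R := ball_subset_ball hα hz
  have hG := T.abs_crossGrad_le_gap hx₀ hx₁ hyR hy₁R
  rw [hd] at hG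
  have hlam2 := T.norm_sub_lt_two hx₀ hx₁
  set l := ‖x₀ - x₁‖ with hl
  have hl0 : 0 < l := lt_of_le_of_lt (mul_nonneg (le_trans (by positivity) hK) hd0) hKd
  have hne : x₀ ≠ x₁ := by
    rintro rfl
    simp [hl] at hl0
  set u := ‖x - x₁‖ with hu
  have hu0 : 0 ≤ u := norm_nonneg _
  set v := |r - r₁| with hv
  have hv0 : 0 ≤ v := abs_nonneg _
  set s := u + v + W with hs_def
  have hs0 : 0 ≤ s := by positivity
  have b1 : 20 * (M ^ 4 * d) ≤ l := by
    linarith [mul_le_mul_of_nonneg_right hK hd0]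
  have b2 : 20 * (M ^ 4 * d) ≤ (α - γ) * l := by
    linarith [mul_le_mul_of_nonneg_right hKγ hd0, mul_le_mul_of_nonneg_left hKd.le hβ.le]
  have b3 : 20 * (M ^ 4 * s) ≤ (α - γ) * l := by
    linarith [mul_le_mul_of_nonneg_right hKγ hs0, mul_le_mul_of_nonneg_left hs.le hβ.le]
  have b4 : 10 * (M ^ 4 * s) ≤ α - γ := by
    have := mul_le_mul_of_nonneg_left hlam2.le hβ.le
    linarith
  have p0 := fun {i : ℕ} (hi : i ≤ 4) => T.pow_mul_le hi hd0
  have q0 := fun {i : ℕ} (hi : i ≤ 4) => T.pow_mul_le hi hs0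
  have hd4 := mul_nonneg (pow_pos hM0 4).le hd0
  have hs4 := mul_nonneg (pow_pos hM0 4).le hs0
  have htan : |crossGrad Φ x₀ x₁ y| ≤ M⁻¹ * l := by
    rw [le_inv_mul_iff₀ hM0]
    have := mul_le_mul_of_nonneg_left hG hM0.le
    linarith [p0 (i := 3) (by norm_num)]
  have hMs : s ≤ M * s := le_mul_of_one_le_left hs0 hM
  have hMu : u ≤ M * u := le_mul_of_one_le_left hu0 hM
  have hMv : v ≤ M * v := le_mul_of_one_le_left hv0 hM
  have hMW : W ≤ M * W := le_mul_of_one_le_left hW hM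
  have hGz : |crossGrad Φ x₀ x₁ z| ≤ M * s := by
    have e1 := T.cross_lip x₀ hx₀ x hx x₁ hx₁ z hzR
    rw [hz₂] at e1
    rw [abs_le] at e1 hW₂ ⊢
    constructor <;> nlinarith
  -- Both `y` and `z` nearly solve the same system for `x₀, x₁`, so injectivity puts `z` near `y`,
  -- leaving room inside B(b, α) for the corrections below.
  have hzy : ‖z - y‖ ≤ (α - γ) / 4 := by
    have e1 := T.inj x₀ hx₀ x₁ hx₁ hne y hyR htan z hzR y hyR
    have e2 : |Φ x₀ z - Φ x₀ y| ≤ s := by rw [hr₀, hz₀]; linarith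
    have e3 : |crossGrad Φ x₀ x₁ z - crossGrad Φ x₀ x₁ y| ≤ M * s + 2 * M ^ 2 * d :=
      (abs_sub _ _).trans (add_le_add hGz hG)
    have e4 : l * |Φ x₀ z - Φ x₀ y| ≤ 2 * s :=
      mul_le_mul hlam2.le e2 (abs_nonneg _) zero_le_two
    have e5 : l * ‖z - y‖ ≤ M * (2 * s + (M * s + 2 * M ^ 2 * d)) :=
      e1.trans (mul_le_mul_of_nonneg_left (add_le_add e4 e3) hM0.le)
    have e6 : l * ‖z - y‖ ≤ l * ((α - γ) / 4) := by
      have := q0 (i := 1) (by norm_num)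
      have := q0 (i := 2) (by norm_num)
      have := p0 (i := 3) (by norm_num)
      linarith
    exact le_of_mul_le_mul_left e6 hl0
  have hzb : dist z b ≤ γ + (α - γ) / 4 := by
    have := dist_triangle z y b
    rw [mem_closedBall] at hy
    rw [dist_eq_norm z y] at this
    linarith
  have hq1 := q0 (i := 1) (by norm_num)
  have hq2 := q0 (i := 2) (by norm_num)
  have hq3 := q0 (i := 3) (by norm_num)
  have hball₀ : closedBall z (M * s) ⊆ ball b α := closedBall_subset_ball' (by linarith)
  have hball₁ : closedBall z (M ^ 2 * s) ⊆ ball b α := closedBall_subset_ball' (by linarith)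
  -- Only the radius has to be corrected. Prescribing the wedge at its value at `z` makes `l`
  -- cancel, so the displacement is O(s) rather than O(s/l); likewise for `z₁`, with the two centres
  -- exchanged.
  obtain ⟨z₀, hz₀', h1, -⟩ := T.surj x₀ hx₀ x₁ hx₁ hne y hyR htan z (M * s) r₀
    (crossGrad Φ x₀ x₁ z) (by positivity) (hball₀.trans (ball_subset_ball hα)) (by
      rw [sub_self, abs_zero, add_zero, abs_sub_comm, hz₀]
      have : |w₀| ≤ s := by linarith
      calc M * (l * |w₀|) ≤ M * (l * s) := by gcongr
        _ = _ := by ring)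
  obtain ⟨z₁, hz₁', h2, -⟩ := T.surj x₁ hx₁ x₀ hx₀ hne.symm y hyR
    (by rw [crossGrad_swap, abs_neg, norm_sub_rev]; exact htan) z (M ^ 2 * s) r₁
    (crossGrad Φ x₁ x₀ z) (by positivity) (hball₁.trans (ball_subset_ball hα)) (by
      rw [sub_self, abs_zero, add_zero, norm_sub_rev, ← hl]
      have : |r₁ - Φ x₁ z| ≤ M * s := by
        have e1 := T.lip x hx x₁ hx₁ z hzR z hzR
        rw [sub_self, norm_zero, add_zero, ← hu] at e1
        have e2 := le_abs_self (r - r₁)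
        have e3 := neg_abs_le (r - r₁)
        rw [abs_le] at e1 hW₁ ⊢
        constructor <;> linarith
      calc M * (l * |r₁ - Φ x₁ z|) ≤ M * (l * (M * s)) := by gcongr
        _ = _ := by ring)
  refine ⟨z₀, hball₀ hz₀', z₁, hball₁ hz₁', h1, h2, ?_⟩
  have hz₀R := ball_subset_ball hα (hball₀ hz₀')
  have hz₁R := ball_subset_ball hα (hball₁ hz₁')
  rw [mem_closedBall, dist_eq_norm] at hz₀' hz₁'
  have n0 := T.normal_le x₀ hx₀ x₁ hx₁ z hzR
  have n1 := T.normal_lip x₀ hx₀ x₀ hx₀ z₀ hz₀R z hzR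
  have n2 := T.normal_lip x₁ hx₁ x₁ hx₁ z₁ hz₁R z hzR
  rw [sub_self, norm_zero, zero_add] at n1 n2
  have n3 := norm_sub_le_norm_sub_add_norm_sub (unitNormal Φ x₀ z₀) (unitNormal Φ x₀ z)
    (unitNormal Φ x₁ z₁)
  have n4 := norm_sub_le_norm_sub_add_norm_sub (unitNormal Φ x₀ z) (unitNormal Φ x₁ z)
    (unitNormal Φ x₁ z₁)
  rw [norm_sub_rev (unitNormal Φ x₁ z)] at n4
  have n5 := norm_sub_le_norm_sub_add_norm_sub z₀ z z₁
  rw [norm_sub_rev z] at n5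
  have m0 := mul_le_mul_of_nonneg_left hGz hM0.le
  have m1 := mul_le_mul_of_nonneg_left hz₀' hM0.le
  have m2 := mul_le_mul_of_nonneg_left hz₁' hM0.le
  have m3 := mul_le_mul_of_nonneg_right hK hs0
  linarith

/-- A perturbed tangency persists when the centre of the second curve moves a little. -/
theorem exists_tangency_of_near_centre {x₀ x x' y : Plane} {r₀ r γ α K t W : ℝ} {w₀ w₁ w₂ : ℝ}
    (hx₀ : x₀ ∈ ball a R) (hx : x ∈ ball a R) (hx' : x' ∈ ball a R) (hγ : γ < α) (hα : α ≤ R)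
    (hK : 20 * M ^ 4 ≤ K) (hKγ : 20 * M ^ 4 ≤ K * (α - γ))
    (hy : y ∈ ball b γ) (hW₂ : |w₂| ≤ W)
    (hKW : K * W ≤ ‖x - x₀‖) (hKt : K * t < ‖x - x₀‖) (hxt : ‖x - x'‖ < t)
    (hr₀ : Φ x₀ y - r₀ = w₀) (hr : Φ x y - r = w₁) (hG : crossGrad Φ x₀ x y = w₂) :
    ∃ y' ∈ ball b α, Φ x₀ y' - r₀ = w₀ ∧ crossGrad Φ x₀ x' y' = w₂ ∧
      |r - (Φ x' y' - w₁)| < K * t := by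
  have hM := T.one_le
  have hM0 : 0 < M := by linarith
  have hW : 0 ≤ W := (abs_nonneg _).trans hW₂
  have hβ := sub_pos.2 hγ
  have hK0 : 0 < K := lt_of_lt_of_le (by positivity) hK
  have hyR : y ∈ ball b R := ball_subset_ball (hγ.le.trans hα) hy
  set u := ‖x - x'‖ with hu
  have hu0 : 0 ≤ u := norm_nonneg _
  set l := ‖x - x₀‖ with hl
  set l' := ‖x₀ - x'‖ with hl'
  have hKu : K * u < l := (mul_lt_mul_of_pos_left hxt hK0).trans hKt
  have hl0 : 0 < l := lt_of_le_of_lt (by positivity) hKu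
  have b1 : 20 * (M ^ 4 * u) ≤ l := by linarith [mul_le_mul_of_nonneg_right hK hu0]
  have b2 : 20 * (M ^ 4 * W) ≤ l := by linarith [mul_le_mul_of_nonneg_right hK hW]
  have b3 : 20 * (M ^ 4 * u) ≤ (α - γ) * l := by
    linarith [mul_le_mul_of_nonneg_right hKγ hu0, mul_le_mul_of_nonneg_left hKu.le hβ.le]
  have p0 := fun {i : ℕ} (hi : i ≤ 4) => T.pow_mul_le hi hu0
  have q0 := fun {i : ℕ} (hi : i ≤ 4) => T.pow_mul_le hi hW
  have p4 := mul_nonneg (pow_pos hM0 4).le hu0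
  -- The distances of the old and the new centre from `x₀` are comparable, so near-tangency passes
  -- to `x'`.
  have hll' : l < 2 * l' := by
    have e1 := norm_sub_le_norm_sub_add_norm_sub x x' x₀
    rw [norm_sub_rev x' x₀] at e1
    have e2 := p0 (i := 0) (by norm_num)
    rw [pow_zero, one_mul] at e2
    linarith
  have hl'0 : 0 < l' := by linarith
  have hne : x₀ ≠ x' := by
    rintro rfl
    simp [hl'] at hl'0
  have e1 := T.cross_lip x₀ hx₀ x hx x' hx' y hyR
  rw [hG] at e1
  have htan : |crossGrad Φ x₀ x' y| ≤ M⁻¹ * l' := by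
    rw [le_inv_mul_iff₀ hM0]
    have e2 : |crossGrad Φ x₀ x' y| ≤ W + M * u := by
      rw [abs_le] at e1 hW₂ ⊢
      constructor <;> linarith
    have e3 := mul_le_mul_of_nonneg_left e2 hM0.le
    have := p0 (i := 2) (by norm_num)
    have := q0 (i := 1) (by norm_num)
    linarith
  set s := M ^ 2 * u / l' with hs
  have hs0 : 0 ≤ s := by positivity
  have hls : l' * s = M ^ 2 * u := by rw [hs]; field_simp
  have hsβ : s < α - γ := by
    by_contra! hcon
    have e1 := mul_le_mul_of_nonneg_left hcon hl'0.le
    have e2 : 0 < l' * (α - γ) := mul_pos hl'0 hβ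
    have e3 := p0 (i := 2) (by norm_num)
    have e4 := mul_le_mul_of_nonneg_left hll'.le hβ.le
    linarith
  have hball : closedBall y s ⊆ ball b α := by
    refine closedBall_subset_ball' ?_
    rw [mem_ball] at hy
    linarith
  -- The value of Φ(x₀,·) is kept and only the wedge is corrected, by at most M·u. With `mixed`,
  -- this again makes the change of radius O(u).
  obtain ⟨y', hy', h1, h2⟩ := T.surj x₀ hx₀ x' hx' hne y hyR htan y s (Φ x₀ y) w₂ hs0
    (hball.trans (ball_subset_ball hα)) (by
      rw [sub_self, abs_zero, mul_zero, zero_add, hls]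
      linarith [mul_le_mul_of_nonneg_left e1 hM0.le])
  refine ⟨y', hball hy', by rw [h1, hr₀], h2, ?_⟩
  have hy'R := ball_subset_ball hα (hball hy')
  have m1 := T.mixed x' hx' x₀ hx₀ y' hy'R y hyR
  have m2 := T.lip x' hx' x hx y hyR y hyR
  rw [norm_sub_rev x' x₀, ← hl', h1] at m1
  rw [sub_self, norm_zero, add_zero, norm_sub_rev x' x, ← hu] at m2
  have m3 : M * (l' * ‖y' - y‖) ≤ M ^ 3 * u := by
    rw [mem_closedBall, dist_eq_norm] at hy'
    calc M * (l' * ‖y' - y‖) ≤ M * (l' * s) := by gcongr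
      _ = _ := by rw [hls]; ring
  have m4 := p0 (i := 3) (by norm_num)
  have m5 := p0 (i := 1) (by norm_num)
  have m6 := mul_le_mul_of_nonneg_right hK hu0
  have m7 := mul_lt_mul_of_pos_left hxt hK0
  refine lt_of_le_of_lt ?_ m7
  rw [abs_le] at m1 m2 ⊢
  constructor <;> linarith

end TangencyBounds

/-! ### The surface as a smooth graph; attainment of the gap -/

namespace TangencyBounds

variable {Φ : Plane → Plane → ℝ} {a b : Plane} {M R : ℝ} (T : TangencyBounds Φ a b M R)
include T

theorem eq_of_tangency {x x' y y' : Plane} {r c : ℝ} (hx : x ∈ ball a R) (hx' : x' ∈ ball a R)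
    (hne : x ≠ x') (hc : |c| ≤ M⁻¹ * ‖x - x'‖) (hy : y ∈ ball b R) (hy' : y' ∈ ball b R)
    (h1 : Φ x y = r) (h2 : crossGrad Φ x x' y = c) (h1' : Φ x y' = r)
    (h2' : crossGrad Φ x x' y' = c) : y = y' := by
  have h := T.inj x hx x' hx' hne y hy (by rwa [h2]) y hy y' hy'
  rw [h1, h1', h2, h2', sub_self, sub_self, abs_zero, mul_zero, add_zero, mul_zero] at h
  have hpos := norm_pos_iff.2 (sub_ne_zero.2 hne)
  have : ‖y - y'‖ ≤ 0 := by nlinarith [norm_nonneg (y - y')]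
  exact sub_eq_zero.1 (norm_le_zero_iff.1 this)

/-- Implicit function theorem for the two equations in `y`; `T.deriv` gives injectivity of the
partial derivative, hence invertibility between planes. -/
theorem exists_local_solution {x₀ x y : Plane} {r c : ℝ} (hx₀ : x₀ ∈ ball a R)
    (hx : x ∈ ball a R) (hne : x₀ ≠ x) (hc : |c| ≤ M⁻¹ * ‖x₀ - x‖) (hy : y ∈ ball b R)
    (h1 : Φ x₀ y = r) (h2 : crossGrad Φ x₀ x y = c) :
    ∃ ψ : Plane → Plane, ContDiffAt ℝ ∞ ψ x ∧ ψ x = y ∧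
      ∀ᶠ x' in 𝓝 x, Φ x₀ (ψ x') = r ∧ crossGrad Φ x₀ x' (ψ x') = c := by
  let f : Plane × Plane → ℝ × ℝ := fun z => (Φ x₀ z.2, crossGrad Φ x₀ z.1 z.2)
  have d1 : ContDiffAt ℝ ∞ (Φ x₀) y := contDiffAt_slice (T.contDiffAt x₀ hx₀ y hy)
  have d2 : ContDiffAt ℝ ∞ (fun z : Plane × Plane => crossGrad Φ x₀ z.1 z.2) (x, y) :=
    ContDiffAt.comp (g := fun z : (Plane × Plane) × Plane => crossGrad Φ z.1.1 z.1.2 z.2)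
      (f := fun z : Plane × Plane => ((x₀, z.1), z.2)) (x, y)
      (contDiffAt_crossGrad (T.contDiffAt x₀ hx₀ y hy) (T.contDiffAt x hx y hy)) (by fun_prop)
  have hf : ContDiffAt ℝ ∞ f (x, y) := (d1.comp (x, y) contDiffAt_snd).prodMk d2
  have e : HasFDerivAt (fun z => f (x, z)) (fderiv ℝ f (x, y) ∘L .inr ℝ Plane Plane) y :=
    ((hf.differentiableAt (by simp)).hasFDerivAt).comp y (hasFDerivAt_prodMk_right x y)
  have e' : HasFDerivAt (fun z => f (x, z))
      ((fderiv ℝ (Φ x₀) y).prod (fderiv ℝ (crossGrad Φ x₀ x) y)) y :=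
    (d1.differentiableAt (by simp)).hasFDerivAt.prodMk
      ((contDiffAt_slice d2).differentiableAt (by simp)).hasFDerivAt
  have hinv : (fderiv ℝ f (x, y) ∘L .inr ℝ Plane Plane).IsInvertible := by
    rw [e.unique e']
    set A := (fderiv ℝ (Φ x₀) y).prod (fderiv ℝ (crossGrad Φ x₀ x) y)
    have hinj : Function.Injective (A : Plane →ₗ[ℝ] ℝ × ℝ) := by
      rw [← LinearMap.ker_eq_bot, LinearMap.ker_eq_bot']
      intro v hv
      exact T.deriv x₀ hx₀ x hx hne y hy (by rwa [h2]) y hy v (congrArg Prod.fst hv)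
        (congrArg Prod.snd hv)
    refine ⟨(LinearEquiv.ofInjectiveOfFinrankEq (A : Plane →ₗ[ℝ] ℝ × ℝ) hinj
      (by simp)).toContinuousLinearEquiv, ?_⟩
    ext v <;> rfl
  refine ⟨hf.implicitFunction (by simp) hinv, hf.contDiffAt_implicitFunction _ hinv,
    hf.implicitFunction_apply_self (by simp) hinv, ?_⟩
  filter_upwards [hf.eventually_apply_implicitFunction (by simp) hinv] with x' hx'
  exact ⟨(congrArg Prod.fst hx').trans h1, (congrArg Prod.snd hx').trans h2⟩

/-- Because |c| ≤ κ/M, every solution with |x − x₀| > κ is itself the near-tangency witness that the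
estimates require. Uniqueness therefore holds throughout the region, and the solution chosen
pointwise agrees with the local implicit functions. -/
theorem exists_solution_map {x₀ : Plane} {r c κ ρ α : ℝ} (hx₀ : x₀ ∈ ball a R) (hρ : ρ ≤ R)
    (hα : α ≤ R) (hκ : 0 ≤ κ) (hc : |c| ≤ M⁻¹ * κ) :
    ∃ (O : Set Plane) (Y : Plane → Plane), IsOpen O ∧ ContDiffOn ℝ ∞ Y O ∧
      O ⊆ ball a ρ ∧ (∀ x ∈ O, κ < ‖x - x₀‖ ∧ Y x ∈ ball b α) ∧
      ∀ x ∈ ball a ρ, κ < ‖x - x₀‖ → ∀ y ∈ ball b α,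
        (Φ x₀ y = r ∧ crossGrad Φ x₀ x y = c) ↔ (x ∈ O ∧ y = Y x) := by
  classical
  have hM0 : 0 < M := by linarith [T.one_le]
  let O : Set Plane := {x | x ∈ ball a ρ ∧ κ < ‖x - x₀‖ ∧
    ∃ y ∈ ball b α, Φ x₀ y = r ∧ crossGrad Φ x₀ x y = c}
  let Y : Plane → Plane := fun x => if h : x ∈ O then h.2.2.choose else 0
  have hY : ∀ x ∈ O, Y x ∈ ball b α ∧ Φ x₀ (Y x) = r ∧ crossGrad Φ x₀ x (Y x) = c := by
    intro x hx
    simp only [Y, dif_pos hx]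
    exact hx.2.2.choose_spec
  have hfar : ∀ x, κ < ‖x - x₀‖ → x₀ ≠ x ∧ |c| ≤ M⁻¹ * ‖x₀ - x‖ := by
    intro x hx
    refine ⟨?_, ?_⟩
    · rintro rfl
      rw [sub_self, norm_zero] at hx
      linarith
    · rw [norm_sub_rev]
      exact hc.trans (mul_le_mul_of_nonneg_left hx.le (inv_nonneg.2 hM0.le))
  have huniq : ∀ x ∈ O, ∀ y ∈ ball b α, Φ x₀ y = r → crossGrad Φ x₀ x y = c → y = Y x := by
    intro x hx y hy h1 h2
    obtain ⟨k1, k2, k3⟩ := hY x hx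
    obtain ⟨f1, f2⟩ := hfar x hx.2.1
    exact T.eq_of_tangency hx₀ (ball_subset_ball hρ hx.1) f1 f2 (ball_subset_ball hα hy)
      (ball_subset_ball hα k1) h1 h2 k2 k3
  have hloc : ∀ x ∈ O, O ∈ 𝓝 x ∧ ContDiffAt ℝ ∞ Y x := by
    intro x hx
    obtain ⟨k1, k2, k3⟩ := hY x hx
    obtain ⟨f1, f2⟩ := hfar x hx.2.1
    obtain ⟨ψ, s1, s2, s3⟩ := T.exists_local_solution hx₀ (ball_subset_ball hρ hx.1) f1 f2
      (ball_subset_ball hα k1) k2 k3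
    have t1 : ∀ᶠ x' in 𝓝 x, ψ x' ∈ ball b α :=
      s1.continuousAt.eventually_mem (isOpen_ball.mem_nhds (by rwa [s2]))
    have t2 : ∀ᶠ x' in 𝓝 x, x' ∈ ball a ρ := isOpen_ball.mem_nhds hx.1
    have t3 : ∀ᶠ x' in 𝓝 x, κ < ‖x' - x₀‖ :=
      ((continuous_id.sub continuous_const).norm.continuousAt).eventually_const_lt hx.2.1
    have t4 : ∀ᶠ x' in 𝓝 x, x' ∈ O := by
      filter_upwards [t1, t2, t3, s3] with x' u1 u2 u3 u4
      exact ⟨u2, u3, ψ x', u1, u4⟩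
    refine ⟨t4, s1.congr_of_eventuallyEq ?_⟩
    filter_upwards [t1, t4, s3] with x' u1 u2 u3
    exact (huniq x' u2 _ u1 u3.1 u3.2).symm
  refine ⟨O, Y, isOpen_iff_mem_nhds.2 fun x hx => (hloc x hx).1,
    fun x hx => (hloc x hx).2.contDiffWithinAt, fun x hx => hx.1,
    fun x hx => ⟨hx.2.1, (hY x hx).1⟩, fun x hx hκx y hy => ⟨fun h => ?_, ?_⟩⟩
  · have hO : x ∈ O := ⟨hx, hκx, y, hy, h⟩
    exact ⟨hO, huniq x hO y hy h.1 h.2⟩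
  · rintro ⟨hO, rfl⟩
    exact (hY x hO).2

/-- With Y(x) the unique tangency point, the radius must be Φ(x, Y(x)) − w₁. The whole surface is
thus a single graph, cut down to the open set where this radius lies in `J`. -/
theorem tangencySurface_eq_graph {x₀ : Plane} {r₀ κ ρ α : ℝ} {J : Set ℝ}
    {w : EuclideanSpace ℝ (Fin 3)} (hJ : IsOpen J) (hx₀ : x₀ ∈ ball a R) (hρ : ρ ≤ R)
    (hα : α ≤ R) (hκ : 0 ≤ κ) (hw : ‖w‖ ≤ M⁻¹ * κ) :
    ∃ (V : Set Plane) (f : Plane → ℝ), IsOpen V ∧ ContDiffOn ℝ ∞ f V ∧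
      tangencySurface Φ (ball a ρ) J (ball b α) w κ (x₀, r₀)
        = {q : CurveParam | q.1 ∈ V ∧ q.2 = f q.1} := by
  obtain ⟨O, Y, hO, hYs, hOρ, hOY, hiff⟩ := T.exists_solution_map (r := r₀ + w 0) (c := w 2)
    hx₀ hρ hα hκ ((PiLp.norm_apply_le w 2).trans hw)
  have hf : ContDiffOn ℝ ∞ (fun x => Φ x (Y x) - w 1) O := by
    intro x hx
    refine ContDiffWithinAt.sub ?_ contDiffWithinAt_const
    exact ContDiffAt.comp_contDiffWithinAt (g := fun z : Plane × Plane => Φ z.1 z.2)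
      (f := fun x => (x, Y x)) x
      (T.contDiffAt x (ball_subset_ball hρ (hOρ hx)) (Y x) (ball_subset_ball hα (hOY x hx).2))
      (contDiffWithinAt_id.prodMk (hYs x hx))
  refine ⟨O ∩ (fun x => Φ x (Y x) - w 1) ⁻¹' J, fun x => Φ x (Y x) - w 1,
    hf.continuousOn.isOpen_inter_preimage hO hJ, hf.mono inter_subset_left, ?_⟩
  ext ⟨x, r⟩
  constructor
  · rintro ⟨⟨⟨⟨x', r'⟩, y⟩, ⟨h1, h2, h3, h4, h5, h6⟩, heq⟩, h7⟩
    obtain ⟨rfl, rfl⟩ := Prod.mk.inj heq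
    obtain ⟨k1, k2⟩ := (hiff x' h1 h7 y h3).1 ⟨by linarith, h6⟩
    have h8 : r' = Φ x' (Y x') - w 1 := by
      rw [← k2]; simp only at h5; linarith
    exact ⟨⟨k1, by rw [mem_preimage, ← h8]; exact h2⟩, h8⟩
  · rintro ⟨⟨h1, h2⟩, h3⟩
    obtain ⟨k1, k2⟩ := hOY x h1
    obtain ⟨k3, k4⟩ := (hiff x (hOρ h1) k1 (Y x) k2).2 ⟨h1, rfl⟩
    simp only at h3
    refine ⟨⟨((x, r), Y x), ⟨hOρ h1, ?_, k2, ?_, ?_, k4⟩, rfl⟩, k1⟩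
    · rw [h3]; exact h2
    · simp only [k3]; ring
    · simp only [h3]; ring

/-- The infimum runs over a compact set, nonempty when the gap is finite, and is attained; estimates
can then be made in real numbers. -/
theorem exists_tangencyGap_eq {x x' : Plane} {r r' s : ℝ} (hx : x ∈ ball a R)
    (hx' : x' ∈ ball a R) (hs : 0 < s) (hsR : s < R)
    (hfin : tangencyGap Φ (ball b s) (x, r) (x', r') ≠ ⊤) :
    ∃ y ∈ closedBall b s, ∃ y' ∈ closedBall b s, Φ x y = r ∧ Φ x' y' = r' ∧
      tangencyGap Φ (ball b s) (x, r) (x', r')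
        = ENNReal.ofReal (‖y - y'‖ + ‖unitNormal Φ x y - unitNormal Φ x' y'‖) := by
  have hsub : closedBall b s ⊆ ball b R := closedBall_subset_ball hsR
  have hcont : ∀ x ∈ ball a R, ContinuousOn (Φ x) (closedBall b s) := fun x hx y hy =>
    (contDiffAt_slice (T.contDiffAt x hx y (hsub hy))).continuousAt.continuousWithinAt
  have hn : ∀ x ∈ ball a R, ContinuousOn (unitNormal Φ x) (closedBall b s) := by
    intro x hx
    have : LipschitzOnWith (Real.toNNReal M) (unitNormal Φ x) (closedBall b s) := by
      refine LipschitzOnWith.of_dist_le_mul fun y hy y' hy' => ?_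
      have h := T.normal_lip x hx x hx y (hsub hy) y' (hsub hy')
      rw [Real.coe_toNNReal _ (by linarith [T.one_le]), dist_eq_norm, dist_eq_norm]
      simpa using h
    exact this.continuousOn
  have hclosed : ∀ x ∈ ball a R, ∀ r, IsCompact {y | y ∈ closedBall b s ∧ Φ x y = r} := by
    intro x hx r
    exact (isCompact_closedBall b s).of_isClosed_subset
      ((hcont x hx).preimage_isClosed_of_isClosed isClosed_closedBall isClosed_singleton)
      fun y hy => hy.1
  have hgap : tangencyGap Φ (ball b s) (x, r) (x', r') =
      ⨅ y ∈ {y | y ∈ closedBall b s ∧ Φ x y = r}, ⨅ y' ∈ {y' | y' ∈ closedBall b s ∧ Φ x' y' = r'},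
        edist y y' + edist (unitNormal Φ x y) (unitNormal Φ x' y') := by
    rw [tangencyGap, closure_ball b hs.ne']
  have hne : ({y | y ∈ closedBall b s ∧ Φ x y = r} ×ˢ
      {y' | y' ∈ closedBall b s ∧ Φ x' y' = r'}).Nonempty := by
    by_contra hemp
    apply hfin
    rw [hgap]
    simp only [iInf_eq_top]
    intro y hy y' hy'
    exact (hemp ⟨(y, y'), hy, hy'⟩).elim
  have hF : ContinuousOn (fun z : Plane × Plane => edist z.1 z.2
      + edist (unitNormal Φ x z.1) (unitNormal Φ x' z.2))
      ({y | y ∈ closedBall b s ∧ Φ x y = r} ×ˢ {y' | y' ∈ closedBall b s ∧ Φ x' y' = r'}) := by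
    refine ContinuousOn.add (by fun_prop) ?_
    refine continuous_edist.comp_continuousOn (ContinuousOn.prodMk ?_ ?_)
    · exact (hn x hx).comp continuousOn_fst fun z hz => hz.1.1
    · exact (hn x' hx').comp continuousOn_snd fun z hz => hz.2.1
  obtain ⟨⟨y, y'⟩, ⟨hy, hy'⟩, hmin⟩ :=
    ((hclosed x hx r).prod (hclosed x' hx' r')).exists_isMinOn hne hF
  refine ⟨y, hy.1, y', hy'.1, hy.2, hy'.2, ?_⟩
  rw [ENNReal.ofReal_add (norm_nonneg _) (norm_nonneg _), ← dist_eq_norm, ← dist_eq_norm,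
    ← edist_dist, ← edist_dist, hgap]
  refine le_antisymm ?_ ?_
  · exact iInf₂_le_of_le y hy (iInf₂_le_of_le y' hy' le_rfl)
  · exact le_iInf₂ fun z hz => le_iInf₂ fun z' hz' => isMinOn_iff.1 hmin (z, z') ⟨hz, hz'⟩

end TangencyBounds

theorem tangencyGap_le {Φ : Plane → Plane → ℝ} {X : Set Plane} {x x' y y' : Plane} {r r' : ℝ}
    (hy : y ∈ closure X) (hy' : y' ∈ closure X) (h : Φ x y = r) (h' : Φ x' y' = r') :
    tangencyGap Φ X (x, r) (x', r')
      ≤ ENNReal.ofReal (‖y - y'‖ + ‖unitNormal Φ x y - unitNormal Φ x' y'‖) := by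
  rw [ENNReal.ofReal_add (norm_nonneg _) (norm_nonneg _), ← dist_eq_norm, ← dist_eq_norm,
    ← edist_dist, ← edist_dist]
  exact iInf₂_le_of_le y ⟨hy, h⟩ (iInf₂_le_of_le y' ⟨hy', h'⟩ le_rfl)

theorem tangencyGap_anti {Φ : Plane → Plane → ℝ} {X X' : Set Plane} (hX : X ⊆ X')
    (p q : CurveParam) : tangencyGap Φ X' p q ≤ tangencyGap Φ X p q :=
  le_iInf₂ fun y hy => le_iInf₂ fun y' hy' =>
    iInf₂_le_of_le y ⟨closure_mono hX hy.1, hy.2⟩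
      (iInf₂_le_of_le y' ⟨closure_mono hX hy'.1, hy'.2⟩ le_rfl)

/-! ### Assembly of the estimates -/

theorem mainTheorem3
    (Φ : Plane → Plane → ℝ) (U : Set (Plane × Plane)) (hU : IsOpen U)
    (a b : Plane) (hab : (a, b) ∈ U)
    (hΦ : ContDiffOn ℝ ∞ (fun z : Plane × Plane => Φ z.1 z.2) U)
    (hcin : CinematicCurvature Φ a b) :
    ∃ ε : ℝ, 0 < ε ∧ ∀ ρ α : ℝ, 0 < ρ → ρ ≤ ε → 0 < α → α ≤ ε →
    ∀ C : ℝ, 1 < C → ∃ K : ℝ, 1 ≤ K ∧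
    ∀ J : Set ℝ, IsOpen J → ∀ A δ : ℝ, 1 ≤ A → 0 ≤ δ →
    ∀ w : EuclideanSpace ℝ (Fin 3), ‖w‖ ≤ K⁻¹ * δ →
    ∀ x₀ ∈ Metric.ball a ρ, ∀ r₀ ∈ J,
      -- comparison of the distance to the surface with the tangency gap
      (∀ x₁ ∈ Metric.ball a ρ, ∀ r₁ ∈ J,
        tangencyGap Φ (Metric.ball b (C⁻¹ * α)) (x₀, r₀) (x₁, r₁)
            < ENNReal.ofReal (K⁻¹ * ‖x₀ - x₁‖) →
        (A * δ < ‖x₁ - x₀‖ →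
          (∀ r : ℝ, edist r r₁ ≤ ENNReal.ofReal K *
              (tangencyGap Φ (Metric.ball b (C⁻¹ * α)) (x₀, r₀) (x₁, r₁)
                + ENNReal.ofReal ‖w‖) → r ∈ J) →
          (∃ r' : ℝ,
            edist r' r₁ ≤ ENNReal.ofReal K *
              (tangencyGap Φ (Metric.ball b (C⁻¹ * α)) (x₀, r₀) (x₁, r₁)
                + ENNReal.ofReal ‖w‖) ∧
            (x₁, r') ∈ tangencySurface Φ (Metric.ball a ρ) J (Metric.ball b α) w (A * δ)
              (x₀, r₀)) ∧
          distToSurface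
              (tangencySurface Φ (Metric.ball a ρ) J (Metric.ball b α) w (A * δ) (x₀, r₀))
              (x₁, r₁)
            ≤ ENNReal.ofReal K *
              (tangencyGap Φ (Metric.ball b (C⁻¹ * α)) (x₀, r₀) (x₁, r₁)
                + ENNReal.ofReal ‖w‖)) ∧
        tangencyGap Φ (Metric.ball b α) (x₀, r₀) (x₁, r₁)
          ≤ ENNReal.ofReal K *
            (distToSurface
              (tangencySurface Φ (Metric.ball a ρ) J (Metric.ball b α) w (A * δ) (x₀, r₀))
              (x₁, r₁) + ENNReal.ofReal ‖w‖)) ∧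
      -- the surface is smooth, two-dimensional and locally a graph over the centres
      IsSmoothSurface
        (tangencySurface Φ (Metric.ball a ρ) J (Metric.ball b α) w (A * δ) (x₀, r₀)) ∧
      IsLocallySmoothGraph
        (tangencySurface Φ (Metric.ball a ρ) J (Metric.ball b α) w (A * δ) (x₀, r₀)) ∧
      -- truncated cylinders around a point of the surface
      (∀ (x : Plane) (r t : ℝ),
        (x, r) ∈ tangencySurface Φ (Metric.ball a ρ) J (Metric.ball b (C⁻¹ * α)) w (A * δ)
          (x₀, r₀) →
        t < K⁻¹ * ‖x - x₀‖ →
        Set.Ioo (r - K * t) (r + K * t) ⊆ J →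
        Prod.fst '' (tangencySurface Φ (Metric.ball a ρ) J (Metric.ball b α) w (A * δ) (x₀, r₀) ∩
            {q : CurveParam | ‖x - q.1‖ < t ∧ |r - q.2| < K * t})
          = {x' : Plane | ‖x - x'‖ < t} ∩
            {x' : Plane | x' ∈ Metric.ball a ρ ∧ A * δ < ‖x' - x₀‖}) := by
  have h : ∀ᶠ z in 𝓝 (a, b), ContDiffAt ℝ ∞ (fun z : Plane × Plane => Φ z.1 z.2) z := by
    filter_upwards [hU.mem_nhds hab] with z hz using hΦ.contDiffAt (hU.mem_nhds hz)
  obtain ⟨M, hM⟩ := (eventually_tangencyBounds h hcin).exists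
  obtain ⟨R, T⟩ := hM.exists
  have hM1 := T.one_le
  have hM0 : 0 < M := by linarith
  have hM4 : 1 ≤ M ^ 4 := one_le_pow₀ hM1
  have hR0 := T.pos
  refine ⟨R / 2, half_pos hR0, fun ρ α hρ0 hρ hα0 hα C hC => ?_⟩
  have hρR : ρ ≤ R := by linarith
  have hαR : α < R := by linarith
  have hγ0 : 0 < C⁻¹ * α := by positivity
  have hγ : C⁻¹ * α < α := mul_lt_of_lt_one_left hα0 (inv_lt_one_of_one_lt₀ hC)
  set γ := C⁻¹ * α
  have hβ := sub_pos.2 hγ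
  -- The first summand absorbs the constants of the perturbation lemmas; the second keeps displaced
  -- points from leaving B(b, α) when they start in B(b, γ).
  set K := 20 * M ^ 4 + 20 * M ^ 4 / (α - γ) with hKdef
  have hK : 20 * M ^ 4 ≤ K := le_add_of_nonneg_right (by positivity)
  have hKγ : 20 * M ^ 4 ≤ K * (α - γ) := by
    rw [hKdef, add_mul, div_mul_cancel₀ _ hβ.ne']
    exact le_add_of_nonneg_left (by positivity)
  have hK1 : 1 ≤ K := by linarith
  have hK0 : 0 < K := by linarith
  have hMK : M ≤ K := by
    have := le_self_pow₀ hM1 (n := 4) (by norm_num)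
    linarith
  have hMball := fun {x : Plane} (hx : x ∈ ball a ρ) => ball_subset_ball hρR hx
  refine ⟨K, hK1, fun J hJ A δ hA hδ w hw x₀ hx₀ r₀ hr₀ => ?_⟩
  have hKw : K * ‖w‖ ≤ δ := (le_inv_mul_iff₀ hK0).1 hw
  have hδA : δ ≤ A * δ := le_mul_of_one_le_left hδ hA
  have hw0 := PiLp.norm_apply_le w 0
  have hw1 := PiLp.norm_apply_le w 1
  have hw2 := PiLp.norm_apply_le w 2
  rw [Real.norm_eq_abs] at hw0 hw1 hw2
  have hwM : ‖w‖ ≤ M⁻¹ * (A * δ) := by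
    rw [le_inv_mul_iff₀ hM0]
    exact (mul_le_mul_of_nonneg_right hMK (norm_nonneg w)).trans (hKw.trans hδA)
  obtain ⟨V, f, hV, hf, hS⟩ := T.tangencySurface_eq_graph (r₀ := r₀) hJ (hMball hx₀) hρR hαR.le
    (mul_nonneg (by linarith) hδ) hwM
  refine ⟨?_, hS ▸ isSmoothSurface_graph hV hf, hS ▸ isLocallySmoothGraph_graph hV hf, ?_⟩
  · clear hS hf hV f V
    intro x₁ hx₁ r₁ hr₁ hgap
    obtain ⟨y, hy, y₁, hy₁, e0, e1, hd⟩ := T.exists_tangencyGap_eq (hMball hx₀) (hMball hx₁) hγ0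
      (hγ.trans hαR) hgap.ne_top
    have hgap' := hgap
    rw [hd] at hgap ⊢
    generalize hd' : ‖y - y₁‖ + ‖unitNormal Φ x₀ y - unitNormal Φ x₁ y₁‖ = d at hgap hd ⊢
    have hd0 : 0 ≤ d := hd' ▸ by positivity
    have hKd : K * d < ‖x₀ - x₁‖ :=
      (lt_inv_mul_iff₀ hK0).1 (ENNReal.ofReal_lt_ofReal_iff'.1 hgap).1
    rw [← ENNReal.ofReal_add hd0 (norm_nonneg w), ← ENNReal.ofReal_mul hK0.le]
    constructor
    · intro hfar hJr
      rw [norm_sub_rev] at hfar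
      obtain ⟨y', hy', k1, k2, k3⟩ := T.exists_perturbed_tangency (hMball hx₀) (hMball hx₁) hγ
        hαR.le hK hKγ hy hy₁ e0 e1 hd' hKd hw0 hw1 hw2 ((hKw.trans hδA).trans hfar.le)
      have hedist : edist (Φ x₁ y' - w 1) r₁ ≤ ENNReal.ofReal (K * (d + ‖w‖)) := by
        rw [edist_dist, Real.dist_eq]
        exact ENNReal.ofReal_le_ofReal k3
      have hmem : (x₁, Φ x₁ y' - w 1) ∈ tangencySurface Φ (ball a ρ) J (ball b α) w (A * δ)
          (x₀, r₀) := by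
        refine ⟨⟨((x₁, Φ x₁ y' - w 1), y'), ⟨hx₁, hJr _ hedist, hy', k1, ?_, k2⟩, rfl⟩, ?_⟩
        · simp
        · rw [norm_sub_rev] at hfar; exact hfar
      refine ⟨⟨_, hedist, hmem⟩, (iInf₂_le _ hmem).trans ?_⟩
      rw [edist_self, zero_add]
      exact hedist
    · have hKtop : ENNReal.ofReal K ≠ ⊤ := ENNReal.ofReal_ne_top
      have hKne : ENNReal.ofReal K ≠ 0 := (ENNReal.ofReal_pos.2 hK0).ne'
      -- Isolating the distance reduces the bound to one point of the surface at a time and covers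
      -- the empty surface without a separate case.
      rw [mul_comm, ← ENNReal.div_le_iff_le_mul (Or.inl hKne) (Or.inl hKtop),
        ← tsub_le_iff_right]
      refine le_iInf₂ ?_
      rintro ⟨x, r⟩ ⟨⟨⟨⟨x', r'⟩, z⟩, ⟨h1, h2, h3, h4, h5, h6⟩, heq⟩, h7⟩
      obtain ⟨rfl, rfl⟩ := Prod.mk.inj heq
      rw [tsub_le_iff_right, ENNReal.div_le_iff_le_mul (Or.inl hKne) (Or.inl hKtop),
        edist_dist, edist_dist, dist_eq_norm, Real.dist_eq,
        ← ENNReal.ofReal_add (norm_nonneg _) (abs_nonneg _),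
        ← ENNReal.ofReal_add (by positivity) (norm_nonneg w), mul_comm,
        ← ENNReal.ofReal_mul hK0.le]
      by_cases hs : K * (‖x' - x₁‖ + |r' - r₁| + ‖w‖) < ‖x₀ - x₁‖
      · obtain ⟨z₀, hz₀, z₁, hz₁, k1, k2, k3⟩ := T.exists_near_tangency (hMball hx₀) (hMball hx₁)
          (hMball h1) hγ hαR.le hK hKγ hy hy₁ e0 hd' hKd hw0 hw1 hw2 h3 h4 h5 h6 hs
        exact (tangencyGap_le (subset_closure hz₀) (subset_closure hz₁) k1 k2).trans
          (ENNReal.ofReal_le_ofReal k3)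
      -- Far from the surface the bound is trivial: the gap is already below |x₀ − x₁|/K.
      · refine (tangencyGap_anti (ball_subset_ball hγ.le) _ _).trans (hgap'.le.trans ?_)
        refine ENNReal.ofReal_le_ofReal (le_trans ?_ (not_lt.1 hs))
        exact mul_le_of_le_one_left (norm_nonneg _) (inv_le_one_of_one_le₀ hK1)
  · intro x r t hmem ht hJt
    have hKt : K * t < ‖x - x₀‖ := (lt_inv_mul_iff₀ hK0).1 ht
    obtain ⟨⟨⟨⟨x', r'⟩, y⟩, ⟨h1, h2, h3, h4, h5, h6⟩, heq⟩, h7⟩ := hmem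
    obtain ⟨rfl, rfl⟩ := Prod.mk.inj heq
    have h7' : A * δ < ‖x' - x₀‖ := h7
    ext z
    constructor
    · rintro ⟨⟨z', s⟩, ⟨⟨⟨⟨⟨z'', s'⟩, y'⟩, hinc, heq⟩, hfar⟩, hclose⟩, rfl⟩
      obtain ⟨rfl, rfl⟩ := Prod.mk.inj heq
      exact ⟨hclose.1, hinc.1, hfar⟩
    · rintro ⟨hz, hzρ, hzfar⟩
      obtain ⟨y', hy', k1, k2, k3⟩ := T.exists_tangency_of_near_centre (hMball hx₀) (hMball h1)
        (hMball hzρ) hγ hαR.le hK hKγ h3 hw2 ((hKw.trans hδA).trans h7'.le) hKt hz h4 h5 h6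
      refine ⟨(z, Φ z y' - w 1), ⟨⟨⟨((z, Φ z y' - w 1), y'), ⟨hzρ, hJt ?_, hy', k1, ?_, k2⟩,
        rfl⟩, hzfar⟩, hz, k3⟩, rfl⟩
      · rw [abs_lt] at k3
        constructor <;> linarith
      · simp
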